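/- **Setting.** Let $f$ be a zero-mean Gaussian process on $\mathbb{R}^D$ with covariance $k(x,x')=\sigma_f^2\exp\{-\sum_{d=1}^D (x_d-x_d')^2/l_d^2\}$, where $\sigma_f,l_d>0$. There are $M$ agents (a fixed number). At stage $n$ each agent $i$ has $n$ observations $y=f(x)+\epsilon$ with i.i.d. noise $\epsilon\sim\mathcal N(0,\sigma_\epsilon^2)$ independent of $f$, $\sigma_\epsilon>0$; they form its local dataset $\mathcal D_i$, and $N=Mn$ is the total number of observations. Assume infill: for every agent $i$ there is a nonempty open set $U_i\subseteq\mathbb{R}^D$ (for instance the interior of the cell in which the agent collects its data) such that the inputs of agent $i$ come arbitrarily close to each point of $U_i$ as $n\to\infty$. Each agent shares a sample $\mathcal D_{-i}\subseteq\mathcal D_i$ of $\lfloor n/M\rfloor$ of its observations (any choice of samples is allowed); put $\mathcal D_c=\bigcup_i\mathcal D_{-i}$ and $\mathcal D_{+i}=\mathcal D_i\cup\mathcal D_c$. For a dataset $(X,\boldsymbol y)$ and a location $x_*$ write $C=k(X,X)+\sigma_\epsilon^2 I$, $k_*=k(X,x_*)$ and let $$\mu(x_*)=k_*^{\top}C^{-1}\boldsymbol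 y,\qquad \sigma^2(x_*)=k(x_*,x_*)-k_*^{\top}C^{-1}k_* ;$$ the indices $\mathrm{full}$, $c$, $+i$ refer to all the data, to $\mathcal D_c$ and to $\mathcal D_{+i}$. **Method (DEC-NN-grBCM).** Let $\mathcal V_{\rm NN}$ be the set of the agents $i$ with $k_{i,*}^{\top}C_i^{-1}k_{i,*}\ge\eta$, computed from $\mathcal D_i$, for a threshold $\eta<\sigma_f^2$, and let $M_{\rm NN}$ be its cardinality. Put $\beta_i=\tfrac12(\log\sigma_c^2-\log\sigma_{+i}^2)$; optionally the weight of one designated agent is replaced by $1$. The agents communicate over an undirected time-varying graph $\mathcal G(t)=(\{1,\dots,M\},\mathcal E(t))$. The agents of $\mathcal V_{\rm NN}$ run, over the subgraph of $\mathcal G(t)$ that they induce and from any starting time, the average consensus iteration (DAC) $$w_i^{(s+1)}=w_i^{(s)}+\varepsilon\sum_{j}a_{ij}(t)\,(w_j^{(s)}-w_i^{(s)}),$$ where $a_{ij}(t)$ is the adjacency matrix, three times, from the initial values $\beta_i\sigma_{+i}^{-2}\mu_{+i}$, $\beta_i\sigma_{+i}^{-2}$ and $\beta_i$. Let $w_{\mu,i}^{(s)},w_{\sigma,i}^{(s)},w_{\beta,i}^{(s)}$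 be the iterates. Agent $i\in\mathcal V_{\rm NN}$ forms $$\sigma_{i,s}^{-2}=M_{\rm NN}w_{\sigma,i}^{(s)}+(1-M_{\rm NN}w_{\beta,i}^{(s)})\sigma_c^{-2},\qquad \mu_{i,s}=\sigma_{i,s}^{2}\big(M_{\rm NN}w_{\mu,i}^{(s)}-(M_{\rm NN}w_{\beta,i}^{(s)}-1)\sigma_c^{-2}\mu_c\big).$$ **Proposition.** Assume that for some integer $\gamma\ge1$ the graph with edge set $\mathcal E(t\gamma)\cup\mathcal E(t\gamma+1)\cup\dots\cup\mathcal E((t+1)\gamma-1)$ is connected for all $t\in\mathbb{N}$. Let $\varepsilon>0$ satisfy $\varepsilon\Delta<1$, where $\Delta=\max_t\max_i\deg_{\mathcal G(t)}(i)$, or $\varepsilon<2/M$. Then, for every $x_*\in\mathbb{R}^D$: 1. for all large $n$, for any initialization $w^{(0)}\in\mathbb{R}^{\mathcal V_{\rm NN}}$ and any starting time, the DAC among the agents of $\mathcal V_{\rm NN}$ converges at each of them to the average of the entries of $w^{(0)}$; 2. for all large $n$, $\mathcal V_{\rm NN}\neq\emptyset$ and, as $s\to\infty$, $\mu_{i,s}$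 and $\sigma^2_{i,s}$ converge to limits $\mu_{\rm NN}(x_*)$ and $\sigma^2_{\rm NN}(x_*)$ that depend neither on the agent $i\in\mathcal V_{\rm NN}$ nor on the starting time; 3. DEC-NN-grBCM is consistent: as $N\to\infty$, $$\mathbb E\big[(\mu_{\rm full}(x_*)-\mu_{\rm NN}(x_*))^2\big]\to0\qquad\text{and}\qquad \sigma^2_{\rm full}(x_*)-\sigma^2_{\rm NN}(x_*)\to0 .$$ -/

import Mathlib

open MeasureTheory ProbabilityTheory Filter Topology
open scoped ENNReal

noncomputable section

namespace DecGP

/-! ### Gaussian process regression -/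

/-- The space of inputs. -/
abbrev Input (D : ℕ) : Type := EuclideanSpace ℝ (Fin D)

/-- Hyperparameters: length-scales, signal standard deviation, noise standard deviation. -/
structure Hyper (D : ℕ) where
  len : Fin D → ℝ
  sigF : ℝ
  sigE : ℝ
  len_pos : ∀ d, 0 < len d
  sigF_pos : 0 < sigF
  sigE_pos : 0 < sigE

/-- The separable squared exponential covariance function. -/
def kernel {D : ℕ} (θ : Hyper D) (x x' : Input D) : ℝ :=
  θ.sigF ^ 2 * Real.exp (-∑ d, (x d - x' d) ^ 2 / θ.len d ^ 2)

/-- The covariance matrix `K + σ_ε² I` of the noisy observations at the inputs `X`. -/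
def covMatrix {D : ℕ} {ι : Type} [DecidableEq ι] (θ : Hyper D) (X : ι → Input D) :
    Matrix ι ι ℝ :=
  Matrix.of (fun a b => kernel θ (X a) (X b)) + θ.sigE ^ 2 • (1 : Matrix ι ι ℝ)

/-- The vector of covariances between the inputs `X` and the location `x`. -/
def covVec {D : ℕ} {ι : Type} (θ : Hyper D) (X : ι → Input D) (x : Input D) : ι → ℝ :=
  fun a => kernel θ (X a) x

/-- The scalar `k_*ᵀ C⁻¹ k_*`. -/
def crossCov {D : ℕ} {ι : Type} [Fintype ι] [DecidableEq ι] (θ : Hyper D)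
    (X : ι → Input D) (x : Input D) : ℝ :=
  covVec θ X x ⬝ᵥ ((covMatrix θ X)⁻¹.mulVec (covVec θ X x))

/-- The prediction mean `k_*ᵀ C⁻¹ y` of a Gaussian process given the data `(X, y)`. -/
def gpMean {D : ℕ} {ι : Type} [Fintype ι] [DecidableEq ι] (θ : Hyper D)
    (X : ι → Input D) (y : ι → ℝ) (x : Input D) : ℝ :=
  covVec θ X x ⬝ᵥ ((covMatrix θ X)⁻¹.mulVec y)

/-- The prediction variance `k_** - k_*ᵀ C⁻¹ k_*` of a Gaussian process given inputs `X`. -/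
def gpVar {D : ℕ} {ι : Type} [Fintype ι] [DecidableEq ι] (θ : Hyper D)
    (X : ι → Input D) (x : Input D) : ℝ :=
  kernel θ x x - crossCov θ X x

/-! ### Datasets

With `n` observations for each of `M` agents, `(i, j)` labels the `j`-th observation of agent `i`;
a dataset is a finite set of labels. -/

/-- The inputs of all agents, and the sample which every agent shares:
`n / M` of its own observations. -/
structure Design (M D n : ℕ) where
  X : Fin M × Fin n → Input D
  sample : Fin M → Finset (Fin n)
  card_sample : ∀ i, (sample i).card = n / M

/-- The local dataset of agent `i`. -/
def localData {M D n : ℕ} (_d : Design M D n) (i : Fin M) : Finset (Fin M × Fin n) :=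
  Finset.univ.filter (fun p => p.1 = i)

/-- The communication dataset: all the shared samples. -/
def commData {M D n : ℕ} (d : Design M D n) : Finset (Fin M × Fin n) :=
  Finset.univ.filter (fun p => p.2 ∈ d.sample p.1)

/-- The local augmented dataset of agent `i`. -/
def augData {M D n : ℕ} (d : Design M D n) (i : Fin M) : Finset (Fin M × Fin n) :=
  localData d i ∪ commData d

/-- Prediction mean at `x` given the dataset `S`. -/
def meanOn {M D n : ℕ} (θ : Hyper D) (d : Design M D n) (y : Fin M × Fin n → ℝ)
    (S : Finset (Fin M × Fin n)) (x : Input D) : ℝ :=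
  gpMean θ (fun p : S => d.X p) (fun p : S => y p) x

/-- Prediction variance at `x` given the dataset `S`. -/
def varOn {M D n : ℕ} (θ : Hyper D) (d : Design M D n)
    (S : Finset (Fin M × Fin n)) (x : Input D) : ℝ :=
  gpVar θ (fun p : S => d.X p) x

/-! ### Covariance-based nearest neighbours (CBNN) -/

open Classical in
/-- The agents which take part in the prediction at `x`: those whose covariance
`k_{i,*}ᵀ C_i⁻¹ k_{i,*}` with the location `x` is not below the threshold `η`. -/
def selected {M D n : ℕ} (θ : Hyper D) (d : Design M D n) (η : ℝ) (x : Input D) :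
    Finset (Fin M) :=
  Finset.univ.filter
    (fun i => ¬ crossCov θ (fun p : localData d i => d.X p) x < η)

/-! ### Discrete-time average consensus (DAC) -/

/-- The time-varying undirected graph `G` is repeatedly connected: for some window length `γ ≥ 1`,
the union of the edge sets over each window `[tγ, (t+1)γ)` is connected. -/
def RepeatedlyConnected {M : ℕ} (G : ℕ → SimpleGraph (Fin M)) : Prop :=
  ∃ γ : ℕ, 0 < γ ∧ ∀ t : ℕ, (⨆ τ ∈ Finset.Ico (t * γ) ((t + 1) * γ), G τ).Connected

/-- The network which the graph `g` induces on the agents in `V`. -/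
def subnetwork {M : ℕ} (V : Finset (Fin M)) (g : SimpleGraph (Fin M)) : SimpleGraph V :=
  g.comap Subtype.val

open Classical in
/-- One DAC step `w_i + ε ∑_j a_ij (w_j - w_i)`. -/
def dacStep {V : Type} [Fintype V] (ε : ℝ) (g : SimpleGraph V) (w : V → ℝ) : V → ℝ :=
  fun i => w i + ε * ∑ j, (if g.Adj i j then 1 else 0) * (w j - w i)

/-- The DAC iterates over the time-varying graph `G`, started at time `t₀` from `w₀`. -/
def dac {V : Type} [Fintype V] (ε : ℝ) (G : ℕ → SimpleGraph V) (t₀ : ℕ) (w₀ : V → ℝ) :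
    ℕ → V → ℝ
  | 0 => w₀
  | s + 1 => dacStep ε (G (t₀ + s)) (dac ε G t₀ w₀ s)

/-! ### DEC-grBCM on the selected agents -/

/-- The weight `β_i = ½ (log σ_c² - log σ_{+i}²)`. With `lead = some l` the weight of agent `l` is
replaced by `1`; with `lead = none` all weights are given by the formula. -/
def beta {M D n : ℕ} (θ : Hyper D) (d : Design M D n) (lead : Option (Fin M)) (x : Input D)
    (i : Fin M) : ℝ :=
  if lead = some i then 1
  else 1 / 2 * (Real.log (varOn θ d (commData d) x) - Real.log (varOn θ d (augData d i) x))

/-- The precision `σ⁻²` which an agent of `V` forms after `s` iterations of the DACs. -/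
def decPrec {M D n : ℕ} (θ : Hyper D) (d : Design M D n) (lead : Option (Fin M))
    (ε : ℝ) (G : ℕ → SimpleGraph (Fin M)) (V : Finset (Fin M)) (x : Input D)
    (t₀ s : ℕ) (i : V) : ℝ :=
  let N := fun t => subnetwork V (G t)
  let wPrec := dac ε N t₀
    (fun j : V => beta θ d lead x j * (varOn θ d (augData d j) x)⁻¹) s i
  let wBeta := dac ε N t₀ (fun j : V => beta θ d lead x j) s i
  V.card * wPrec + (1 - V.card * wBeta) * (varOn θ d (commData d) x)⁻¹

/-- The prediction mean which an agent of `V` forms after `s` iterations of the DACs. -/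
def decMean {M D n : ℕ} (θ : Hyper D) (d : Design M D n) (y : Fin M × Fin n → ℝ)
    (lead : Option (Fin M)) (ε : ℝ) (G : ℕ → SimpleGraph (Fin M)) (V : Finset (Fin M))
    (x : Input D) (t₀ s : ℕ) (i : V) : ℝ :=
  let N := fun t => subnetwork V (G t)
  let wMean := dac ε N t₀
    (fun j : V => beta θ d lead x j * (varOn θ d (augData d j) x)⁻¹
      * meanOn θ d y (augData d j) x) s i
  let wBeta := dac ε N t₀ (fun j : V => beta θ d lead x j) s i
  (decPrec θ d lead ε G V x t₀ s i)⁻¹ *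
    (V.card * wMean - (V.card * wBeta - 1) * (varOn θ d (commData d) x)⁻¹
      * meanOn θ d y (commData d) x)

/-- DEC-NN-grBCM at the location `x`, for the outputs `y`, returns the mean `m` and the variance
`v`: some agent is selected, and whatever the starting time, the values formed by every selected
agent converge to `m` and `v` as the number of DAC iterations grows. -/
def Returns {M D n : ℕ} (θ : Hyper D) (d : Design M D n) (y : Fin M × Fin n → ℝ)
    (lead : Option (Fin M)) (ε η : ℝ) (G : ℕ → SimpleGraph (Fin M)) (x : Input D)
    (m v : ℝ) : Prop :=
  (selected θ d η x).Nonempty ∧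
    ∀ (t₀ : ℕ) (i : selected θ d η x),
      Tendsto (fun s => decMean θ d y lead ε G (selected θ d η x) x t₀ s i) atTop (𝓝 m) ∧
      Tendsto (fun s => (decPrec θ d lead ε G (selected θ d η x) x t₀ s i)⁻¹) atTop (𝓝 v)

/-! ### The probabilistic model and consistency -/

/-- `f` is a zero-mean Gaussian process with covariance function `kernel θ`; for every `n` the
noise variables `e n p` are i.i.d. `N(0, σ_ε²)` and independent of `f`. -/
structure Model {Ω : Type*} [MeasurableSpace Ω] (P : Measure Ω) {M D : ℕ} (θ : Hyper D)
    (f : Input D → Ω → ℝ) (e : (n : ℕ) → Fin M × Fin n → Ω → ℝ) : Prop where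
  gaussian : IsGaussianProcess f P
  mean_zero : ∀ x, ∫ ω, f x ω ∂P = 0
  cov_eq : ∀ x x', covariance (f x) (f x') P = kernel θ x x'
  noise_law : ∀ n p, HasLaw (e n p) (gaussianReal 0 (θ.sigE ^ 2).toNNReal) P
  noise_indep : ∀ n, iIndepFun (e n) P
  noise_indep_f : ∀ n, IndepFun (fun ω x => f x ω) (fun ω p => e n p ω) P

/-- The observed outputs `y = f(x) + noise`. -/
def outputs {Ω : Type*} {M D n : ℕ} (d : Design M D n) (f : Input D → Ω → ℝ)
    (e : Fin M × Fin n → Ω → ℝ) (ω : Ω) : Fin M × Fin n → ℝ :=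
  fun p => f (d.X p) ω + e p ω

/-- The inputs of every agent fill some nonempty open region as `n` grows. -/
def Infill {M D : ℕ} (d : (n : ℕ) → Design M D n) : Prop :=
  ∀ i : Fin M, ∃ U : Set (Input D), IsOpen U ∧ U.Nonempty ∧
    ∀ x ∈ U, ∀ r > 0, ∀ᶠ n in atTop, ∃ j : Fin n, dist ((d n).X (i, j)) x < r

/-- An aggregate prediction `(μA, vA)` is consistent with the full prediction `(μ, v)`: at every
location the difference of the means tends to `0` in mean square, and so does the difference of
the (deterministic) variances. -/
def Consistent {Ω : Type*} [MeasurableSpace Ω] (P : Measure Ω) {D : ℕ}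
    (μ μA : ℕ → Input D → Ω → ℝ) (v vA : ℕ → Input D → ℝ) : Prop :=
  ∀ x, Tendsto (fun n => eLpNorm (fun ω => μ n x ω - μA n x ω) 2 P) atTop (𝓝 0) ∧
    Tendsto (fun n => v n x - vA n x) atTop (𝓝 0)

end DecGP

end

noncomputable section

namespace DecGP

/-! ### Gaussian kernels and density -/

section Gram

variable {E F : Type*} [NormedAddCommGroup E] [InnerProductSpace ℝ E]
  [NormedAddCommGroup F] [InnerProductSpace ℝ F]

/-! The key fact is that under infill each agent's own prediction variance at `x` tends to 0.
Regression is orthogonal projection: in any Hilbert space realisation of the covariances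
(`Realizes`), `gpVar` is the squared distance from `φ x` to the span of the noisy observations. On
the line through `x` and a point of the open set, rescaling turns the squared exponential kernel
into `exp (b s t)`, whose features are power series coefficients. A vector orthogonal to the
features near 0 is therefore zero, so `φ x` lies in the closed span of `φ` over the open set
(`mem_closure_span_image_of_isOpen`). Infill puts arbitrarily many inputs near each point of that
set, and averaging removes the noise (`tendsto_gpVar_zero`).

Consequently `crossCov` tends to `σ_f²`, which exceeds `η`: eventually every agent is selected and
the induced network is the whole one. There the squared norm of the iterates drops at each step by a
multiple of the Laplacian energy, so the energy is summable. Disagreement along the edges of a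
connected window vanishes while the sum is preserved (`tendsto_dac`). The limits are thus explicit
aggregates.

The shared samples need not fill anything, so `σ_c` may stay away from 0 and the weights `β_i` may
be unbounded. Still, the aggregate mean is a combination of means with coefficients summing to 1,
and `agg_single_bound` makes each agent's coefficient at most 4. The communication coefficient times
`σ_c` is controlled by the `σ_{+i}` (`Model.comm_weight_le`). Hence the error is at most a constant
times the sum of the `σ_{+i}`, plus `σ_full`, and all of these vanish. -/

theorem norm_linearCombination_eq_of_gram {τ : Type*} {u : τ → E} {v : τ → F}
    (h : ∀ s t, inner ℝ (u s) (u t) = inner ℝ (v s) (v t)) (c : τ →₀ ℝ) :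
    ‖Finsupp.linearCombination ℝ u c‖ = ‖Finsupp.linearCombination ℝ v c‖ := by
  have : ‖Finsupp.linearCombination ℝ u c‖ ^ 2 = ‖Finsupp.linearCombination ℝ v c‖ ^ 2 := by
    simp only [← real_inner_self_eq_norm_sq, Finsupp.linearCombination_apply, Finsupp.sum,
      sum_inner, inner_sum, inner_smul_left, inner_smul_right, h]
  exact (sq_eq_sq₀ (norm_nonneg _) (norm_nonneg _)).1 this

/-- Membership in a closed span depends only on the Gram matrix. -/
theorem mem_closure_span_of_gram {τ : Type*} {u : τ → E} {v : τ → F}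
    (h : ∀ s t, inner ℝ (u s) (u t) = inner ℝ (v s) (v t)) {S : Set τ} {t : τ}
    (ht : v t ∈ closure (Submodule.span ℝ (v '' S) : Set F)) :
    u t ∈ closure (Submodule.span ℝ (u '' S) : Set E) := by
  rw [Metric.mem_closure_iff] at ht ⊢
  intro δ hδ
  obtain ⟨z, hz, hd⟩ := ht δ hδ
  obtain ⟨c, hc, rfl⟩ := (Finsupp.mem_span_image_iff_linearCombination ℝ).1 hz
  refine ⟨Finsupp.linearCombination ℝ u c,
    (Finsupp.mem_span_image_iff_linearCombination ℝ).2 ⟨c, hc, rfl⟩, ?_⟩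
  have := norm_linearCombination_eq_of_gram h (Finsupp.single t 1 - c)
  simp only [map_sub, Finsupp.linearCombination_single, one_smul] at this
  rwa [dist_eq_norm, this, ← dist_eq_norm]

end Gram

theorem memℓp_expFeature {b : ℝ} (hb : 0 ≤ b) (t : ℝ) :
    Memℓp (fun m : ℕ => √(b ^ m / m.factorial) * t ^ m) 2 := by
  refine memℓp_gen ?_
  have : Summable fun m : ℕ => (b * t ^ 2) ^ m / m.factorial :=
    Real.summable_pow_div_factorial _
  refine this.congr fun m => ?_
  have h0 : 0 ≤ b ^ m / m.factorial := by positivity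
  simp only [ENNReal.toReal_ofNat, Real.rpow_ofNat, Real.norm_eq_abs, sq_abs]
  rw [mul_pow √_, Real.sq_sqrt h0, mul_pow]
  ring

/-- The feature vector in `ℓ²` of the exponential kernel `exp (b t s)`. -/
def expFeature {b : ℝ} (hb : 0 ≤ b) (t : ℝ) : lp (fun _ : ℕ => ℝ) 2 :=
  ⟨_, memℓp_expFeature hb t⟩

theorem inner_expFeature {b : ℝ} (hb : 0 ≤ b) (s t : ℝ) :
    inner ℝ (expFeature hb s) (expFeature hb t) = Real.exp (b * (s * t)) := by
  rw [lp.inner_eq_tsum, Real.exp_eq_exp_ℝ, NormedSpace.exp_eq_tsum_div]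
  refine tsum_congr fun m => ?_
  have h0 : 0 ≤ b ^ m / m.factorial := by positivity
  simp only [expFeature, RCLike.inner_apply, conj_trivial]
  rw [mul_mul_mul_comm, Real.mul_self_sqrt h0, mul_pow, mul_pow]
  ring

/-- A vector `g` orthogonal to the features at all `t` near 0 makes the power series with
coefficients `√(b^m/m!) g m` vanish near 0. Uniqueness of power series kills every coefficient, and
`b > 0` keeps the weights nonzero, so `g = 0`. -/
theorem dense_span_expFeature {b : ℝ} (hb : 0 < b) {S : Set ℝ} (hS : S ∈ 𝓝 0) :
    closure (Submodule.span ℝ (expFeature hb.le '' S) : Set (lp (fun _ : ℕ => ℝ) 2))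
      = Set.univ := by
  rw [← Submodule.topologicalClosure_coe, (Submodule.topologicalClosure_eq_top_iff).2,
    Submodule.top_coe]
  rw [Submodule.eq_bot_iff]
  intro g hg
  have hz : ∀ t ∈ S, HasSum (fun m : ℕ => t ^ m • (√(b ^ m / m.factorial) * g m)) 0 := by
    intro t ht
    have h1 := lp.hasSum_inner (𝕜 := ℝ) (expFeature hb.le t) g
    rw [(Submodule.mem_orthogonal _ _).1 hg _
      (Submodule.subset_span (Set.mem_image_of_mem _ ht))] at h1
    refine h1.congr_fun fun m => ?_
    simp only [expFeature, RCLike.inner_apply, conj_trivial, smul_eq_mul]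
    ring
  set p : FormalMultilinearSeries ℝ ℝ ℝ :=
    FormalMultilinearSeries.ofScalars ℝ (fun m : ℕ => √(b ^ m / m.factorial) * g m) with hp
  have hcoeff : ∀ m, p.coeff m = √(b ^ m / m.factorial) * g m := by
    intro m; simp [hp, FormalMultilinearSeries.coeff_ofScalars]
  have hser : HasFPowerSeriesAt (0 : ℝ → ℝ) p 0 := by
    rw [hasFPowerSeriesAt_iff]
    filter_upwards [hS] with t ht
    simpa [hcoeff] using hz t ht
  have hp0 := hser.eq_zero
  ext m
  have hm := hcoeff m
  have h0 : √(b ^ m / m.factorial) ≠ 0 := by positivity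
  rw [hp0] at hm
  have : √(b ^ m / m.factorial) * g m = 0 := by
    rw [← hm]; rfl
  exact (mul_eq_zero.1 this).resolve_left h0

/-! ### The squared exponential kernel: continuity and propagation from an open set. -/

theorem kernel_self {D : ℕ} (θ : Hyper D) (x : Input D) : kernel θ x x = θ.sigF ^ 2 := by
  simp [kernel]

theorem continuous_kernel_left {D : ℕ} (θ : Hyper D) (x' : Input D) :
    Continuous fun x => kernel θ x x' := by
  unfold kernel
  fun_prop

variable {D : ℕ} {θ : Hyper D} {H : Type*} [NormedAddCommGroup H] [InnerProductSpace ℝ H]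
  {φ : Input D → H}

theorem continuous_of_inner_eq_kernel (hφ : ∀ x x', inner ℝ (φ x) (φ x') = kernel θ x x') :
    Continuous φ := by
  rw [continuous_iff_continuousAt]
  intro u
  rw [ContinuousAt, tendsto_iff_norm_sub_tendsto_zero]
  have h2 : ∀ x, ‖φ x - φ u‖ = √(2 * θ.sigF ^ 2 - 2 * kernel θ x u) := by
    intro x
    rw [← Real.sqrt_sq (norm_nonneg (φ x - φ u)), norm_sub_sq_real, ← real_inner_self_eq_norm_sq,
      ← real_inner_self_eq_norm_sq, hφ, hφ, hφ, kernel_self, kernel_self]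
    congr 1; ring
  simp only [h2]
  have hc : Continuous fun x => √(2 * θ.sigF ^ 2 - 2 * kernel θ x u) :=
    Real.continuous_sqrt.comp (by have := continuous_kernel_left θ u; fun_prop)
  have := hc.tendsto u
  simpa [kernel_self] using this

/-- A process with the squared exponential covariance is determined everywhere, up to mean-square
approximation, by its values on any nonempty open set. -/
theorem mem_closure_span_image_of_isOpen
    (hφ : ∀ x x', inner ℝ (φ x) (φ x') = kernel θ x x')
    {U : Set (Input D)} (hU : IsOpen U) (hne : U.Nonempty) (x : Input D) :
    φ x ∈ closure (Submodule.span ℝ (φ '' U) : Set H) := by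
  obtain ⟨u, hu⟩ := hne
  rcases eq_or_ne x u with rfl | hxu
  · exact subset_closure (Submodule.subset_span ⟨x, hu, rfl⟩)
  set c : ℝ := ∑ d, (x d - u d) ^ 2 / θ.len d ^ 2 with hc
  have hcpos : 0 < c := by
    obtain ⟨d, hd⟩ : ∃ d, x d ≠ u d := by
      by_contra! h
      exact hxu (by ext d; exact h d)
    have hd' : x d - u d ≠ 0 := sub_ne_zero.2 hd
    have := θ.len_pos d
    exact Finset.sum_pos' (fun _ _ => by positivity) ⟨d, Finset.mem_univ _, by positivity⟩
  have hb : 0 < 2 * c := by positivity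
  -- The line with `ℓ 0 = u` in `U` and `ℓ 1 = x`; along it the kernel depends only on `c (s - t)²`.
  set ℓ : ℝ → Input D := fun t => u + t • (x - u) with hℓ
  have hℓc : Continuous ℓ := by fun_prop
  have hS : ℓ ⁻¹' U ∈ 𝓝 (0 : ℝ) :=
    hℓc.continuousAt.preimage_mem_nhds (hU.mem_nhds (by simpa [hℓ] using hu))
  have hker : ∀ s t, kernel θ (ℓ s) (ℓ t) = θ.sigF ^ 2 * Real.exp (-(c * (s - t) ^ 2)) := by
    intro s t
    simp only [kernel, hℓ, hc, Finset.sum_mul]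
    congr 3
    refine Finset.sum_congr rfl fun d _ => ?_
    simp only [PiLp.add_apply, PiLp.smul_apply, PiLp.sub_apply, smul_eq_mul]
    ring
  -- The factors `exp (c s²)` and `exp (c t²)` cancel the squares in `exp (-c (s - t)²)` and leave
  -- `exp (2 c s t)`, the exponential kernel with `b = 2c`.
  have hgram : ∀ s t : ℝ, inner ℝ (Real.exp (c * s ^ 2) • φ (ℓ s)) (Real.exp (c * t ^ 2) • φ (ℓ t))
      = inner ℝ (θ.sigF • expFeature hb.le s) (θ.sigF • expFeature hb.le t) := by
    intro s t
    simp only [inner_smul_left, inner_smul_right, hφ, hker, inner_expFeature, conj_trivial]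
    have : Real.exp (2 * c * (s * t)) =
        Real.exp (c * s ^ 2) * Real.exp (c * t ^ 2) * Real.exp (-(c * (s - t) ^ 2)) := by
      rw [← Real.exp_add, ← Real.exp_add]; congr 1; ring
    rw [this]; ring
  have hdense : θ.sigF • expFeature hb.le 1 ∈ closure
      (Submodule.span ℝ ((fun t => θ.sigF • expFeature hb.le t) '' (ℓ ⁻¹' U)) : Set _) := by
    have : Submodule.span ℝ ((fun t => θ.sigF • expFeature hb.le t) '' (ℓ ⁻¹' U))
        = Submodule.span ℝ (expFeature hb.le '' (ℓ ⁻¹' U)) := by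
      apply le_antisymm
      · rw [Submodule.span_le]
        rintro _ ⟨t, ht, rfl⟩
        exact Submodule.smul_mem _ _ (Submodule.subset_span ⟨t, ht, rfl⟩)
      · rw [Submodule.span_le]
        rintro _ ⟨t, ht, rfl⟩
        rw [← inv_smul_smul₀ θ.sigF_pos.ne' (expFeature hb.le t)]
        exact Submodule.smul_mem _ _ (Submodule.subset_span ⟨t, ht, rfl⟩)
    rw [this, dense_span_expFeature hb hS]
    trivial
  have h1 := mem_closure_span_of_gram hgram hdense
  have hsub : Submodule.span ℝ ((fun t => Real.exp (c * t ^ 2) • φ (ℓ t)) '' (ℓ ⁻¹' U))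
      ≤ Submodule.span ℝ (φ '' U) := by
    rw [Submodule.span_le]
    rintro _ ⟨t, ht, rfl⟩
    exact Submodule.smul_mem _ _ (Submodule.subset_span ⟨ℓ t, ht, rfl⟩)
  have h2 := closure_mono hsub h1
  have hx : ℓ 1 = x := by simp [hℓ]
  rw [← Submodule.topologicalClosure_coe] at h2 ⊢
  have h3 := Submodule.smul_mem _ (Real.exp (c * 1 ^ 2))⁻¹ h2
  rwa [inv_smul_smul₀ (Real.exp_pos _).ne', hx] at h3

/-! ### Gaussian process regression as orthogonal projection -/

/-- `φ` is a Hilbert space realisation of the covariance function, and `ν` an orthogonal family of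
noise vectors, orthogonal to the values of `φ`. -/
structure Realizes {D : ℕ} (θ : Hyper D) {H : Type*} [NormedAddCommGroup H]
    [InnerProductSpace ℝ H] (φ : Input D → H) {ι : Type} (ν : ι → H) : Prop where
  inner_signal : ∀ x x', inner ℝ (φ x) (φ x') = kernel θ x x'
  inner_noise_self : ∀ a, inner ℝ (ν a) (ν a) = θ.sigE ^ 2
  inner_noise_ne : ∀ a b, a ≠ b → inner ℝ (ν a) (ν b) = 0
  inner_signal_noise : ∀ x a, inner ℝ (φ x) (ν a) = 0

/-- The weights `C⁻¹ k_*` of the prediction mean. -/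
def weights {D : ℕ} {ι : Type} [Fintype ι] [DecidableEq ι] (θ : Hyper D)
    (X : ι → Input D) (x : Input D) : ι → ℝ :=
  (covMatrix θ X)⁻¹.mulVec (covVec θ X x)

section Realizes

variable {D : ℕ} {θ : Hyper D} {H : Type*} [NormedAddCommGroup H] [InnerProductSpace ℝ H]
  {φ : Input D → H} {ι : Type} {ν : ι → H} {X : ι → Input D}

theorem Realizes.comp (h : Realizes θ φ ν) {κ : Type} (g : κ → ι) (hg : Function.Injective g) :
    Realizes θ φ (fun k => ν (g k)) where
  inner_signal := h.inner_signal
  inner_noise_self _ := h.inner_noise_self _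
  inner_noise_ne _ _ hab := h.inner_noise_ne _ _ (hg.ne hab)
  inner_signal_noise x _ := h.inner_signal_noise x _

theorem Realizes.inner_noise_sum (h : Realizes θ φ ν) [Fintype ι] (c : ι → ℝ) (b : ι) :
    inner ℝ (∑ a, c a • ν a) (ν b) = θ.sigE ^ 2 * c b := by
  simp only [sum_inner, inner_smul_left, conj_trivial]
  rw [Finset.sum_eq_single b]
  · rw [h.inner_noise_self]; ring
  · intro a _ hab; rw [h.inner_noise_ne a b hab, mul_zero]
  · simp

theorem Realizes.norm_sq_add_noise (h : Realizes θ φ ν) [Fintype ι] (w : ι → ℝ) (v : H)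
    (hv : v ∈ Submodule.span ℝ (Set.range φ)) :
    ‖v + ∑ a, w a • ν a‖ ^ 2 = ‖v‖ ^ 2 + θ.sigE ^ 2 * ∑ a, w a ^ 2 := by
  have h0 : inner ℝ v (∑ a, w a • ν a) = 0 := by
    induction hv using Submodule.span_induction with
    | mem v hv =>
      obtain ⟨z, rfl⟩ := hv
      simp [inner_sum, inner_smul_right, h.inner_signal_noise]
    | zero => simp
    | add x y _ _ hx hy => rw [inner_add_left, hx, hy, add_zero]
    | smul c x _ hx => rw [inner_smul_left, hx, mul_zero]
  rw [norm_add_sq_real, h0, ← real_inner_self_eq_norm_sq (∑ a, w a • ν a), inner_sum]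
  simp only [inner_smul_right, h.inner_noise_sum, Finset.mul_sum]
  rw [mul_zero, add_zero]
  congr 1
  exact Finset.sum_congr rfl fun a _ => by ring

theorem kernel_comm (θ : Hyper D) (x x' : Input D) : kernel θ x x' = kernel θ x' x := by
  rw [kernel, kernel]; simp only [sub_sq_comm (x _)]

theorem covMatrix_comm [DecidableEq ι] (θ : Hyper D) (X : ι → Input D) (a b : ι) :
    covMatrix θ X a b = covMatrix θ X b a := by
  simp only [covMatrix, Matrix.add_apply, Matrix.of_apply, Matrix.smul_apply, Matrix.one_apply,
    kernel_comm θ (X a), eq_comm (a := a)]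

theorem covMatrix_transpose [DecidableEq ι] (θ : Hyper D) (X : ι → Input D) :
    (covMatrix θ X).transpose = covMatrix θ X := by
  ext a b
  exact covMatrix_comm θ X b a

/-- Independent noise contributes only on the diagonal. That `covMatrix` is a Gram matrix is what
turns regression into projection. -/
theorem Realizes.inner_obs [DecidableEq ι] (h : Realizes θ φ ν) (a b : ι) :
    inner ℝ (φ (X a) + ν a) (φ (X b) + ν b) = covMatrix θ X a b := by
  simp only [inner_add_left, inner_add_right, h.inner_signal, h.inner_signal_noise,
    real_inner_comm (φ _) (ν _), covMatrix, Matrix.add_apply, Matrix.of_apply, Matrix.smul_apply,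
    Matrix.one_apply, smul_eq_mul]
  by_cases hab : a = b
  · subst hab; rw [h.inner_noise_self]; simp
  · simp [h.inner_noise_ne a b hab, hab]

variable [Fintype ι] [DecidableEq ι]

/-- If `C w = 0`, the combination of observations with coefficients `w` has norm 0. By Pythagoras
its noise part alone contributes `σ_ε² ∑ w²`, so `w = 0`. -/
theorem Realizes.isUnit_det (h : Realizes θ φ ν) : IsUnit (covMatrix θ X).det := by
  rw [← Matrix.isUnit_iff_isUnit_det, ← Matrix.mulVec_injective_iff_isUnit,
    ← Matrix.coe_mulVecLin, ← LinearMap.ker_eq_bot, LinearMap.ker_eq_bot']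
  intro w hw
  rw [Matrix.mulVecLin_apply] at hw
  have h1 : ‖∑ a, w a • (φ (X a) + ν a)‖ ^ 2 = 0 := by
    rw [← real_inner_self_eq_norm_sq]
    simp only [sum_inner, inner_sum, inner_smul_left, inner_smul_right, h.inner_obs, conj_trivial]
    have hrow : ∀ a, ∑ b, covMatrix θ X a b * w b = 0 := fun a => congrFun hw a
    refine Finset.sum_eq_zero fun a _ => ?_
    rw [← mul_zero (w a), ← hrow a]
    simp only [Finset.mul_sum]
    exact Finset.sum_congr rfl fun b _ => by rw [covMatrix_comm θ X b a]; ring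
  simp only [smul_add, Finset.sum_add_distrib] at h1
  rw [h.norm_sq_add_noise w _ (Submodule.sum_mem _ fun a _ => Submodule.smul_mem _ _
    (Submodule.subset_span ⟨_, rfl⟩))] at h1
  have hE := θ.sigE_pos
  have h2 : ∑ a, w a ^ 2 = 0 := by
    have h3 : 0 ≤ ∑ a, w a ^ 2 := Finset.sum_nonneg fun _ _ => sq_nonneg _
    have h4 : θ.sigE ^ 2 * ∑ a, w a ^ 2 = 0 := by
      have : 0 ≤ θ.sigE ^ 2 * ∑ a, w a ^ 2 := by positivity
      nlinarith [sq_nonneg ‖∑ a, w a • φ (X a)‖]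
    exact (mul_eq_zero.1 h4).resolve_left (by positivity)
  ext a
  have := (Finset.sum_eq_zero_iff_of_nonneg fun _ _ => sq_nonneg _).1 h2 a (Finset.mem_univ a)
  simpa using this

theorem gpMean_eq_sum (θ : Hyper D) (X : ι → Input D) (y : ι → ℝ) (x : Input D) :
    gpMean θ X y x = ∑ a, weights θ X x a * y a := by
  rw [gpMean, Matrix.dotProduct_mulVec, ← Matrix.mulVec_transpose, Matrix.transpose_nonsing_inv,
    covMatrix_transpose]
  rfl

variable (X) in
-- These are the normal equations `C w = k_*`: the prediction mean is the orthogonal projection onto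
-- the span of the observations.
theorem Realizes.inner_residual_obs (h : Realizes θ φ ν) (x : Input D) (b : ι) :
    inner ℝ (φ x - ∑ a, weights θ X x a • (φ (X a) + ν a)) (φ (X b) + ν b) = 0 := by
  have h1 : (covMatrix θ X).mulVec (weights θ X x) b = covVec θ X x b := by
    rw [weights, Matrix.mulVec_mulVec, Matrix.mul_nonsing_inv _ h.isUnit_det, Matrix.one_mulVec]
  rw [inner_sub_left, sum_inner]
  simp only [inner_smul_left, h.inner_obs, conj_trivial]
  rw [inner_add_right, h.inner_signal, h.inner_signal_noise, add_zero, sub_eq_zero]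
  rw [kernel_comm, ← covVec, ← h1]
  change ∑ a, covMatrix θ X b a * weights θ X x a = _
  exact Finset.sum_congr rfl fun a _ => by rw [covMatrix_comm θ X a b, mul_comm]

variable (X) in
theorem Realizes.norm_sq_residual (h : Realizes θ φ ν) (x : Input D) :
    ‖φ x - ∑ a, weights θ X x a • (φ (X a) + ν a)‖ ^ 2 = gpVar θ X x := by
  rw [← real_inner_self_eq_norm_sq]
  conv_lhs => rw [inner_sub_right, inner_sum]
  simp only [inner_smul_right, h.inner_residual_obs, mul_zero, Finset.sum_const_zero, sub_zero]
  rw [inner_sub_left, sum_inner]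
  simp only [inner_smul_left, inner_add_left, h.inner_signal, real_inner_comm (φ _) (ν _),
    h.inner_signal_noise, add_zero, conj_trivial, gpVar, crossCov, dotProduct]
  congr 1
  exact Finset.sum_congr rfl fun a _ => by rw [mul_comm]; rfl

variable (X) in
theorem Realizes.gpVar_le (h : Realizes θ φ ν) (x : Input D) {z : H}
    (hz : z ∈ Submodule.span ℝ (Set.range fun a => φ (X a) + ν a)) :
    gpVar θ X x ≤ ‖φ x - z‖ ^ 2 := by
  rw [← h.norm_sq_residual X x]
  set r := φ x - ∑ a, weights θ X x a • (φ (X a) + ν a) with hr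
  have hd : (∑ a, weights θ X x a • (φ (X a) + ν a)) - z ∈
      Submodule.span ℝ (Set.range fun a => φ (X a) + ν a) :=
    Submodule.sub_mem _ (Submodule.sum_mem _ fun a _ => Submodule.smul_mem _ _
      (Submodule.subset_span ⟨a, rfl⟩)) hz
  have h0 : ∀ v ∈ Submodule.span ℝ (Set.range fun a => φ (X a) + ν a), inner ℝ r v = 0 := by
    intro v hv
    induction hv using Submodule.span_induction with
    | mem v hv => obtain ⟨b, rfl⟩ := hv; exact h.inner_residual_obs X x b
    | zero => simp
    | add x y _ _ hx hy => rw [inner_add_right, hx, hy, add_zero]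
    | smul c x _ hx => rw [inner_smul_right, hx, mul_zero]
  have : φ x - z = r + ((∑ a, weights θ X x a • (φ (X a) + ν a)) - z) := by rw [hr]; abel
  rw [this, norm_add_sq_real, h0 _ hd]
  nlinarith [sq_nonneg ‖(∑ a, weights θ X x a • (φ (X a) + ν a)) - z‖]

variable (X) in
-- Either all weights vanish and the residual is `φ x`, of squared norm `σ_f²`, or the noise in the
-- residual contributes `σ_ε² ∑ w² > 0`.
theorem Realizes.gpVar_pos (h : Realizes θ φ ν) (x : Input D) : 0 < gpVar θ X x := by
  rw [← h.norm_sq_residual X x]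
  have h1 : φ x - ∑ a, weights θ X x a • (φ (X a) + ν a)
      = (φ x - ∑ a, weights θ X x a • φ (X a)) + ∑ a, (-weights θ X x a) • ν a := by
    simp only [smul_add, Finset.sum_add_distrib, neg_smul, Finset.sum_neg_distrib]; abel
  have h2 := h.norm_sq_add_noise (fun a => -weights θ X x a)
    (φ x - ∑ a, weights θ X x a • φ (X a))
    (Submodule.sub_mem _ (Submodule.subset_span ⟨x, rfl⟩) (Submodule.sum_mem _ fun a _ =>
      Submodule.smul_mem _ _ (Submodule.subset_span ⟨_, rfl⟩)))
  rw [h1, h2]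
  simp only [neg_sq]
  have hE := θ.sigE_pos
  have hF := θ.sigF_pos
  by_cases hw : ∀ a, weights θ X x a = 0
  · simp only [hw, zero_smul, Finset.sum_const_zero, sub_zero]
    rw [← real_inner_self_eq_norm_sq, h.inner_signal, kernel_self]
    positivity
  · push Not at hw
    obtain ⟨a, ha⟩ := hw
    have : 0 < ∑ a, weights θ X x a ^ 2 :=
      Finset.sum_pos' (fun _ _ => sq_nonneg _) ⟨a, Finset.mem_univ _, by positivity⟩
    exact add_pos_of_nonneg_of_pos (sq_nonneg _) (mul_pos (pow_pos hE 2) this)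

/-- More data decrease the prediction variance. -/
theorem Realizes.gpVar_le_comp (h : Realizes θ φ ν) {κ : Type} [Fintype κ] [DecidableEq κ]
    (g : κ → ι) (hg : Function.Injective g) (x : Input D) :
    gpVar θ X x ≤ gpVar θ (fun k => X (g k)) x := by
  rw [← (h.comp g hg).norm_sq_residual (fun k => X (g k)) x]
  exact h.gpVar_le X x (Submodule.sum_mem _ fun k _ => Submodule.smul_mem _ _
    (Submodule.subset_span ⟨g k, rfl⟩))

/-- Averaging the observations at distinct labels near `u`. -/
theorem Realizes.exists_span_near (h : Realizes θ φ ν) {u : Input D} {r : ℝ} {s : Finset ι}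
    (hs : s.Nonempty) (hr : ∀ a ∈ s, ‖φ (X a) - φ u‖ ≤ r) :
    ∃ z ∈ Submodule.span ℝ (Set.range fun a => φ (X a) + ν a),
      ‖φ u - z‖ ≤ r + θ.sigE / √s.card := by
  have hc : (0 : ℝ) < s.card := by exact_mod_cast hs.card_pos
  refine ⟨(s.card : ℝ)⁻¹ • ∑ a ∈ s, (φ (X a) + ν a), Submodule.smul_mem _ _
    (Submodule.sum_mem _ fun a _ => Submodule.subset_span ⟨a, rfl⟩), ?_⟩
  -- The error splits into an average of signal differences, each at most `r`, and an average of
  -- orthogonal noise vectors, of norm `σ_ε / √card`.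
  have h1 : φ u - (s.card : ℝ)⁻¹ • ∑ a ∈ s, (φ (X a) + ν a)
      = -((s.card : ℝ)⁻¹ • ∑ a ∈ s, (φ (X a) - φ u)) - (s.card : ℝ)⁻¹ • ∑ a ∈ s, ν a := by
    simp only [Finset.sum_add_distrib, Finset.sum_sub_distrib, Finset.sum_const, smul_add,
      smul_sub]
    rw [← Nat.cast_smul_eq_nsmul ℝ, inv_smul_smul₀ hc.ne']
    abel
  have h2 : ‖(s.card : ℝ)⁻¹ • ∑ a ∈ s, (φ (X a) - φ u)‖ ≤ r := by
    rw [norm_smul, Real.norm_of_nonneg (by positivity), inv_mul_le_iff₀ hc]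
    calc _ ≤ ∑ a ∈ s, ‖φ (X a) - φ u‖ := norm_sum_le _ _
      _ ≤ s.card • r := Finset.sum_le_card_nsmul _ _ _ hr
      _ = _ := by simp
  have h3 : ‖∑ a ∈ s, ν a‖ ^ 2 = θ.sigE ^ 2 * s.card := by
    have := h.norm_sq_add_noise (fun a => if a ∈ s then 1 else 0) 0 (Submodule.zero_mem _)
    simpa [Finset.sum_ite_mem] using this
  have h4 : ‖(s.card : ℝ)⁻¹ • ∑ a ∈ s, ν a‖ = θ.sigE / √s.card := by
    have h5 : ‖∑ a ∈ s, ν a‖ = θ.sigE * √s.card := by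
      rw [← Real.sqrt_sq (norm_nonneg _), h3, Real.sqrt_mul (sq_nonneg _),
        Real.sqrt_sq θ.sigE_pos.le]
    rw [norm_smul, h5, Real.norm_of_nonneg (by positivity), eq_div_iff (by positivity),
      mul_assoc, mul_assoc, Real.mul_self_sqrt hc.le]
    field_simp
  rw [h1]
  calc _ ≤ _ := norm_sub_le _ _
    _ ≤ _ := by rw [norm_neg, h4]; gcongr

end Realizes

/-! ### Vanishing of the prediction variance under infill -/

/-- For contractions, the vectors sent to 0 in the limit form a closed subspace. This replaces
monotonicity in `n`: datasets at different stages need not be nested. -/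
theorem tendsto_of_mem_closure_span {H : Type*} [NormedAddCommGroup H] [InnerProductSpace ℝ H]
    (T : ℕ → H →L[ℝ] H) (hT : ∀ n v, ‖T n v‖ ≤ ‖v‖) {A : Set H}
    (hA : ∀ v ∈ A, Tendsto (fun n => T n v) atTop (𝓝 0)) {v : H}
    (hv : v ∈ closure (Submodule.span ℝ A : Set H)) :
    Tendsto (fun n => T n v) atTop (𝓝 0) := by
  have hspan : ∀ v ∈ Submodule.span ℝ A, Tendsto (fun n => T n v) atTop (𝓝 0) := by
    intro v hv
    induction hv using Submodule.span_induction with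
    | mem v hv => exact hA v hv
    | zero => simp
    | add x y _ _ hx hy => simpa using hx.add hy
    | smul c x _ hx => simpa using hx.const_smul c
  rw [Metric.tendsto_atTop]
  intro δ hδ
  obtain ⟨z, hz, hd⟩ := Metric.mem_closure_iff.1 hv (δ / 2) (by positivity)
  obtain ⟨N, hN⟩ := Metric.tendsto_atTop.1 (hspan z hz) (δ / 2) (by positivity)
  refine ⟨N, fun n hn => ?_⟩
  have h1 := hN n hn
  rw [dist_zero_right] at h1 ⊢
  have h2 : T n v = T n (v - z) + T n z := by rw [map_sub]; abel
  rw [h2]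
  have h3 := hT n (v - z)
  rw [dist_eq_norm] at hd
  linarith [norm_add_le (T n (v - z)) (T n z)]

/-- If the number of inputs near each point of a nonempty open set grows without bound, then the
prediction variance vanishes everywhere. -/
theorem tendsto_gpVar_zero {D : ℕ} {θ : Hyper D} {H : Type*} [NormedAddCommGroup H]
    [InnerProductSpace ℝ H] {φ : Input D → H} {ι : ℕ → Type} [∀ n, Fintype (ι n)]
    [∀ n, DecidableEq (ι n)] {ν : ∀ n, ι n → H} (h : ∀ n, Realizes θ φ (ν n))
    (X : ∀ n, ι n → Input D) {U : Set (Input D)} (hU : IsOpen U) (hne : U.Nonempty)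
    (hfill : ∀ u ∈ U, ∀ r > 0, ∀ k : ℕ, ∀ᶠ n in atTop,
      ∃ s : Finset (ι n), s.card = k ∧ ∀ a ∈ s, dist (X n a) u < r) (x : Input D) :
    Tendsto (fun n => gpVar θ (X n) x) atTop (𝓝 0) := by
  set W : ℕ → Submodule ℝ H := fun n => Submodule.span ℝ (Set.range fun a => φ (X n a) + ν n a)
  have hfin : ∀ n, FiniteDimensional ℝ (W n) := fun n =>
    FiniteDimensional.span_of_finite ℝ (Set.finite_range _)
  -- `T n v` is the part of `v` not explained by the observations of stage `n`; on `φ x` its squared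
  -- norm bounds the prediction variance.
  set T : ℕ → H →L[ℝ] H := fun n => (W n)ᗮ.starProjection
  have hT : ∀ n v, ‖T n v‖ ≤ ‖v‖ := fun n v => Submodule.norm_starProjection_apply_le _ v
  have hT' : ∀ n v, ∀ z ∈ W n, ‖T n v‖ ≤ ‖v - z‖ := by
    intro n v z hz
    have h0 : T n z = 0 := by
      simp [T, Submodule.starProjection_orthogonal, Submodule.starProjection_eq_self_iff.2 hz]
    have := hT n (v - z)
    rwa [map_sub, h0, sub_zero] at this
  have hcont := continuous_of_inner_eq_kernel (h 0).inner_signal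
  have hA : ∀ v ∈ φ '' U, Tendsto (fun n => T n v) atTop (𝓝 0) := by
    rintro _ ⟨u, hu, rfl⟩
    rw [Metric.tendsto_nhds]
    intro δ hδ
    obtain ⟨r, hr, hr'⟩ := Metric.continuousAt_iff.1 (hcont.continuousAt (x := u)) (δ / 2)
      (by positivity)
    obtain ⟨k, hk1, hk⟩ : ∃ k : ℕ, 0 < k ∧ θ.sigE / √k < δ / 2 := by
      have : Tendsto (fun k : ℕ => θ.sigE / √k) atTop (𝓝 0) :=
        Tendsto.const_div_atTop (Real.tendsto_sqrt_atTop.comp tendsto_natCast_atTop_atTop) _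
      exact ((eventually_gt_atTop 0).and
        (this.eventually (gt_mem_nhds (show (0 : ℝ) < δ / 2 by positivity)))).exists
    filter_upwards [hfill u hu r hr k] with n hn
    obtain ⟨s, hs, hsr⟩ := hn
    obtain ⟨z, hz, hle⟩ := (h n).exists_span_near (X := X n) (u := u) (r := δ / 2) (s := s)
      (Finset.card_pos.1 (by omega))
      (fun a ha => by have := hr' (hsr a ha); rw [dist_eq_norm] at this; exact this.le)
    rw [dist_zero_right]
    rw [hs] at hle
    linarith [hT' n (φ u) z hz]
  have hlim := tendsto_of_mem_closure_span T hT hA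
    (mem_closure_span_image_of_isOpen (h 0).inner_signal hU hne x)
  have hsq : Tendsto (fun n => ‖T n (φ x)‖ ^ 2) atTop (𝓝 0) := by
    simpa using hlim.norm.pow 2
  refine squeeze_zero (fun n => ((h n).gpVar_pos (X n) x).le) (fun n => ?_) hsq
  have := (h n).gpVar_le (X n) x ((W n).starProjection_apply_mem (φ x))
  simpa [T, Submodule.starProjection_orthogonal] using this

/-! ### Convergence of the average consensus iteration -/

open Classical in
/-- The Laplacian of `g` applied to `w`. -/
def lap {V : Type} [Fintype V] (g : SimpleGraph V) (w : V → ℝ) : V → ℝ :=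
  fun i => ∑ j, (if g.Adj i j then 1 else 0) * (w i - w j)

open Classical in
/-- The Laplacian bilinear form of `g`, summed over ordered pairs. -/
def lapForm {V : Type} [Fintype V] (g : SimpleGraph V) (u w : V → ℝ) : ℝ :=
  ∑ i, ∑ j, (if g.Adj i j then 1 else 0) * ((u i - u j) * (w i - w j))

section DAC

variable {V : Type} [Fintype V]

theorem dacStep_eq (ε : ℝ) (g : SimpleGraph V) (w : V → ℝ) :
    dacStep ε g w = fun i => w i - ε * lap g w i := by
  funext i
  rw [dacStep, lap, sub_eq_add_neg, ← mul_neg, ← Finset.sum_neg_distrib]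
  congr 2
  exact Finset.sum_congr rfl fun j _ => by ring

/-- Summation by parts; the factor 2 appears because each edge is counted in both orientations. -/
theorem lapForm_eq (g : SimpleGraph V) (u w : V → ℝ) :
    lapForm g u w = 2 * ∑ i, u i * lap g w i := by
  classical
  have h1 : ∑ i, ∑ j, (if g.Adj i j then (1 : ℝ) else 0) * (u j * (w i - w j))
      = -∑ i, u i * lap g w i := by
    rw [Finset.sum_comm, ← Finset.sum_neg_distrib]
    refine Finset.sum_congr rfl fun i _ => ?_
    rw [lap, Finset.mul_sum, ← Finset.sum_neg_distrib]
    refine Finset.sum_congr rfl fun j _ => ?_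
    simp only [g.adj_comm j i]
    ring
  have h2 : ∑ i, ∑ j, (if g.Adj i j then (1 : ℝ) else 0) * (u i * (w i - w j))
      = ∑ i, u i * lap g w i := by
    refine Finset.sum_congr rfl fun i _ => ?_
    rw [lap, Finset.mul_sum]
    exact Finset.sum_congr rfl fun j _ => by ring_nf
  have h3 : lapForm g u w = (∑ i, ∑ j, (if g.Adj i j then (1 : ℝ) else 0) * (u i * (w i - w j)))
      - ∑ i, ∑ j, (if g.Adj i j then (1 : ℝ) else 0) * (u j * (w i - w j)) := by
    simp only [lapForm, ← Finset.sum_sub_distrib]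
    exact Finset.sum_congr rfl fun i _ => Finset.sum_congr rfl fun j _ => by ring
  rw [h3, h1, h2]; ring

theorem sum_lap (g : SimpleGraph V) (w : V → ℝ) : ∑ i, lap g w i = 0 := by
  have := lapForm_eq g (fun _ => 1) w
  simp only [one_mul] at this
  have h0 : lapForm g (fun _ => 1) w = 0 := by simp [lapForm]
  linarith

theorem lapForm_self_nonneg (g : SimpleGraph V) (w : V → ℝ) : 0 ≤ lapForm g w w :=
  Finset.sum_nonneg fun i _ => Finset.sum_nonneg fun j _ =>
    mul_nonneg (by split_ifs <;> norm_num) (mul_self_nonneg _)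

theorem lapForm_sq_le (g : SimpleGraph V) (u w : V → ℝ) :
    lapForm g u w ^ 2 ≤ lapForm g u u * lapForm g w w := by
  classical
  simp only [lapForm, ← Fintype.sum_prod_type']
  refine le_trans (le_of_eq ?_) ((Finset.sum_mul_sq_le_sq_mul_sq Finset.univ
    (fun p : V × V => (if g.Adj p.1 p.2 then 1 else 0) * (u p.1 - u p.2))
    (fun p : V × V => (if g.Adj p.1 p.2 then 1 else 0) * (w p.1 - w p.2))).trans (le_of_eq ?_))
  · congr 1
    exact Finset.sum_congr rfl fun p _ => by split_ifs <;> ring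
  · congr 1 <;> exact Finset.sum_congr rfl fun p _ => by split_ifs <;> ring

/-- A bound of the Laplacian quadratic form bounds the Laplacian. -/
theorem sum_lap_sq_le {g : SimpleGraph V} {c : ℝ}
    (hc : ∀ u, lapForm g u u ≤ 2 * c * ∑ i, u i ^ 2) (w : V → ℝ) :
    2 * ∑ i, lap g w i ^ 2 ≤ c * lapForm g w w := by
  set u := lap g w
  set A := ∑ i, u i ^ 2 with hA
  have hA0 : 0 ≤ A := Finset.sum_nonneg fun _ _ => sq_nonneg _
  -- Testing the form with `u = lap g w` gives `2 ‖u‖²`; Cauchy–Schwarz and the bound on `lapForm g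
  -- u u` then allow one factor `‖u‖²` to be cancelled.
  have h1 : lapForm g u w = 2 * A := by
    rw [lapForm_eq, hA]; congr 1; exact Finset.sum_congr rfl fun i _ => by ring
  have h2 := lapForm_sq_le g u w
  have h3 := hc u
  have h4 := lapForm_self_nonneg g w
  rw [h1] at h2
  -- When the Laplacian vanishes nothing can be cancelled; the sign of `c` then comes from `hc w`,
  -- unless the energy is 0 too.
  rcases hA0.eq_or_lt with h | h
  · rw [← h, mul_zero]
    rcases h4.eq_or_lt with h5 | h5
    · rw [← h5, mul_zero]
    · have h6 := hc w
      have h7 : 0 ≤ ∑ i, w i ^ 2 := Finset.sum_nonneg fun _ _ => sq_nonneg _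
      exact mul_nonneg (by by_contra! hneg; nlinarith) h4
  · have : (2 * A) ^ 2 ≤ (2 * c * A) * lapForm g w w :=
      h2.trans (mul_le_mul_of_nonneg_right h3 h4)
    have h5 : A * (2 * A) ≤ A * (c * lapForm g w w) := by nlinarith
    exact le_of_mul_le_mul_left h5 h

/-- Missing edges only lower the form, and for the complete graph it equals `2 |V| ∑ u² - 2 (∑ u)²`.
-/
theorem lapForm_self_le_card (g : SimpleGraph V) (u : V → ℝ) :
    lapForm g u u ≤ 2 * Fintype.card V * ∑ i, u i ^ 2 := by
  classical
  have h1 : lapForm g u u ≤ ∑ i, ∑ j, (u i - u j) ^ 2 := by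
    refine Finset.sum_le_sum fun i _ => Finset.sum_le_sum fun j _ => ?_
    split_ifs
    · exact le_of_eq (by ring)
    · nlinarith [sq_nonneg (u i - u j)]
  have h2 : ∑ i, ∑ j, (u i - u j) ^ 2 = 2 * Fintype.card V * ∑ i, u i ^ 2 - 2 * (∑ i, u i) ^ 2 := by
    simp only [sub_sq, Finset.sum_add_distrib, Finset.sum_sub_distrib, Finset.sum_const,
      Finset.card_univ, nsmul_eq_mul, ← Finset.mul_sum, ← Finset.sum_mul]
    ring
  nlinarith [sq_nonneg (∑ i, u i)]

open Classical in
-- From `(u i - u j)² ≤ 2 u i² + 2 u j²`, summed over edges. The resulting `c = 2Δ` is why the step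
-- size condition reads `ε Δ < 1`.
theorem lapForm_self_le_degree (g : SimpleGraph V) {Δ : ℝ} (hΔ : ∀ i, (g.degree i : ℝ) ≤ Δ)
    (u : V → ℝ) : lapForm g u u ≤ 2 * (2 * Δ) * ∑ i, u i ^ 2 := by
  have h1 : lapForm g u u ≤ ∑ i, ∑ j, ((if g.Adj i j then 1 else 0) * (2 * u i ^ 2)
      + (if g.Adj i j then 1 else 0) * (2 * u j ^ 2)) := by
    refine Finset.sum_le_sum fun i _ => Finset.sum_le_sum fun j _ => ?_
    split_ifs
    · nlinarith [sq_nonneg (u i + u j)]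
    · simp
  have hrow : ∀ i, ∑ j, (if g.Adj i j then (1 : ℝ) else 0) = g.degree i := by
    intro i
    rw [Finset.sum_boole, ← SimpleGraph.card_neighborFinset_eq_degree,
      SimpleGraph.neighborFinset_eq_filter]
  have h2 : ∑ i, ∑ j, (if g.Adj i j then (1 : ℝ) else 0) * (2 * u i ^ 2)
      = ∑ i, g.degree i * (2 * u i ^ 2) := by
    simp only [← Finset.sum_mul, hrow]
  have h3 : ∑ i, ∑ j, (if g.Adj i j then (1 : ℝ) else 0) * (2 * u j ^ 2)
      = ∑ i, g.degree i * (2 * u i ^ 2) := by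
    rw [Finset.sum_comm, ← h2]
    simp only [g.adj_comm]
  have h4 : ∑ i, (g.degree i : ℝ) * (2 * u i ^ 2) ≤ ∑ i, Δ * (2 * u i ^ 2) :=
    Finset.sum_le_sum fun i _ => mul_le_mul_of_nonneg_right (hΔ i) (by positivity)
  simp only [Finset.sum_add_distrib, h2, h3] at h1
  rw [← Finset.mul_sum, ← Finset.mul_sum] at h4
  linarith

/-! ### Energy descent for the consensus iteration. -/

theorem sum_dacStep (ε : ℝ) (g : SimpleGraph V) (w : V → ℝ) :
    ∑ i, dacStep ε g w i = ∑ i, w i := by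
  rw [dacStep_eq, Finset.sum_sub_distrib, ← Finset.mul_sum, sum_lap, mul_zero, sub_zero]

theorem sum_dac (ε : ℝ) (G : ℕ → SimpleGraph V) (t₀ : ℕ) (w₀ : V → ℝ) (s : ℕ) :
    ∑ i, dac ε G t₀ w₀ s i = ∑ i, w₀ i := by
  induction s with
  | zero => rfl
  | succ s ih => rw [dac, sum_dacStep, ih]

/-- Expand `‖w - ε L w‖²` and absorb `ε² ‖L w‖²` with `sum_lap_sq_le`. The loss is a positive
multiple of the energy when `ε > 0` and `ε c < 2`. -/
theorem sum_dacStep_sq_le {g : SimpleGraph V} {ε c : ℝ}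
    (hc : ∀ u, lapForm g u u ≤ 2 * c * ∑ i, u i ^ 2) (w : V → ℝ) :
    ∑ i, dacStep ε g w i ^ 2 ≤ ∑ i, w i ^ 2 - ε * (2 - ε * c) / 2 * lapForm g w w := by
  have h1 : ∑ i, dacStep ε g w i ^ 2
      = ∑ i, w i ^ 2 - ε * (2 * ∑ i, w i * lap g w i) + ε ^ 2 * ∑ i, lap g w i ^ 2 := by
    rw [dacStep_eq, Finset.mul_sum, Finset.mul_sum, Finset.mul_sum, ← Finset.sum_sub_distrib,
      ← Finset.sum_add_distrib]
    exact Finset.sum_congr rfl fun i _ => by ring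
  rw [h1, ← lapForm_eq]
  nlinarith [mul_le_mul_of_nonneg_left (sum_lap_sq_le hc w) (sq_nonneg ε)]

/-- The Laplacian energy of the iterates tends to zero. -/
theorem tendsto_lapForm_dac {ε c : ℝ} (hε : 0 < ε) (hεc : ε * c < 2) {G : ℕ → SimpleGraph V}
    (hc : ∀ t u, lapForm (G t) u u ≤ 2 * c * ∑ i, u i ^ 2) (t₀ : ℕ) (w₀ : V → ℝ) :
    Tendsto (fun s => lapForm (G (t₀ + s)) (dac ε G t₀ w₀ s) (dac ε G t₀ w₀ s)) atTop (𝓝 0) := by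
  set κ := ε * (2 - ε * c) / 2 with hκ
  have hκ0 : 0 < κ := by
    have : 0 < 2 - ε * c := by linarith
    positivity
  set A : ℕ → ℝ := fun s => lapForm (G (t₀ + s)) (dac ε G t₀ w₀ s) (dac ε G t₀ w₀ s)
  have hA : ∀ s, 0 ≤ A s := fun s => lapForm_self_nonneg _ _
  -- Telescoping the descent: the total energy spent never exceeds the initial squared norm.
  have hstep : ∀ n, κ * ∑ s ∈ Finset.range n, A s + ∑ i, dac ε G t₀ w₀ n i ^ 2
      ≤ ∑ i, w₀ i ^ 2 := by
    intro n
    induction n with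
    | zero => simp [dac]
    | succ n ih =>
      have := sum_dacStep_sq_le (ε := ε) (hc (t₀ + n)) (dac ε G t₀ w₀ n)
      rw [← hκ] at this
      rw [Finset.sum_range_succ, mul_add, dac]
      change _ ≤ _ - κ * A n at this
      linarith
  refine (summable_of_sum_range_le hA (c := κ⁻¹ * ∑ i, w₀ i ^ 2) fun n => ?_).tendsto_atTop_zero
  rw [← div_eq_inv_mul, le_div_iff₀ hκ0]
  have : 0 ≤ ∑ i, dac ε G t₀ w₀ n i ^ 2 := Finset.sum_nonneg fun _ _ => sq_nonneg _
  linarith [hstep n]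

theorem tendsto_zero_of_sq {a : ℕ → ℝ} (h : Tendsto (fun s => a s ^ 2) atTop (𝓝 0)) :
    Tendsto a atTop (𝓝 0) := by
  have := (Real.continuous_sqrt.tendsto 0).comp h
  simp only [Real.sqrt_zero, Function.comp_def, Real.sqrt_sq_eq_abs] at this
  exact (tendsto_zero_iff_abs_tendsto_zero _).2 this

/-- Successive iterates approach each other. -/
theorem tendsto_dac_succ_sub {ε c : ℝ} (hε : 0 < ε) (hεc : ε * c < 2) {G : ℕ → SimpleGraph V}
    (hc : ∀ t u, lapForm (G t) u u ≤ 2 * c * ∑ i, u i ^ 2) (t₀ : ℕ) (w₀ : V → ℝ) (i : V) :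
    Tendsto (fun s => dac ε G t₀ w₀ (s + 1) i - dac ε G t₀ w₀ s i) atTop (𝓝 0) := by
  refine tendsto_zero_of_sq ?_
  have h0 := (tendsto_lapForm_dac hε hεc hc t₀ w₀).const_mul (ε ^ 2 * c / 2)
  rw [mul_zero] at h0
  refine squeeze_zero (fun s => sq_nonneg _) (fun s => ?_) h0
  have h1 := sum_lap_sq_le (hc (t₀ + s)) (dac ε G t₀ w₀ s)
  have h2 := Finset.single_le_sum (f := fun i => lap (G (t₀ + s)) (dac ε G t₀ w₀ s) i ^ 2)
    (fun _ _ => sq_nonneg _) (Finset.mem_univ i)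
  rw [dac, dacStep_eq]
  nlinarith [mul_le_mul_of_nonneg_left (h2.trans (by linarith :
    _ ≤ c / 2 * lapForm (G (t₀ + s)) (dac ε G t₀ w₀ s) (dac ε G t₀ w₀ s))) (sq_nonneg ε)]

theorem tendsto_dac_add_sub {ε c : ℝ} (hε : 0 < ε) (hεc : ε * c < 2) {G : ℕ → SimpleGraph V}
    (hc : ∀ t u, lapForm (G t) u u ≤ 2 * c * ∑ i, u i ^ 2) (t₀ : ℕ) (w₀ : V → ℝ) (i : V)
    (k : ℕ) :
    Tendsto (fun s => dac ε G t₀ w₀ (s + k) i - dac ε G t₀ w₀ s i) atTop (𝓝 0) := by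
  induction k with
  | zero => simp
  | succ k ih =>
    have h1 := (tendsto_dac_succ_sub hε hεc hc t₀ w₀ i).comp (tendsto_add_atTop_nat k)
    have := h1.add ih
    rw [add_zero] at this
    refine this.congr fun s => ?_
    simp only [Function.comp_def, add_assoc]
    ring

open Classical in
/-- The disagreement along the edges present `k` steps later vanishes. -/
theorem tendsto_edge_sub {ε c : ℝ} (hε : 0 < ε) (hεc : ε * c < 2) {G : ℕ → SimpleGraph V}
    (hc : ∀ t u, lapForm (G t) u u ≤ 2 * c * ∑ i, u i ^ 2) (t₀ : ℕ) (w₀ : V → ℝ) (i j : V)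
    (k : ℕ) :
    Tendsto (fun s => (if (G (t₀ + (s + k))).Adj i j then (1 : ℝ) else 0) *
      |dac ε G t₀ w₀ s i - dac ε G t₀ w₀ s j|) atTop (𝓝 0) := by
  have hE : Tendsto (fun s => (if (G (t₀ + s)).Adj i j then (1 : ℝ) else 0) *
      |dac ε G t₀ w₀ s i - dac ε G t₀ w₀ s j|) atTop (𝓝 0) := by
    refine tendsto_zero_of_sq ?_
    refine squeeze_zero (fun s => sq_nonneg _) (fun s => ?_) (tendsto_lapForm_dac hε hεc hc t₀ w₀)
    set w := dac ε G t₀ w₀ s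
    have hnn : ∀ i j, 0 ≤ (if (G (t₀ + s)).Adj i j then (1 : ℝ) else 0)
        * ((w i - w j) * (w i - w j)) := fun i j =>
      mul_nonneg (by split_ifs <;> norm_num) (mul_self_nonneg _)
    have h1 := Finset.single_le_sum (f := fun j => (if (G (t₀ + s)).Adj i j then (1 : ℝ) else 0)
        * ((w i - w j) * (w i - w j))) (fun j _ => hnn i j) (Finset.mem_univ j)
    have h2 := Finset.single_le_sum (f := fun i => ∑ j, (if (G (t₀ + s)).Adj i j then (1 : ℝ) else 0)
        * ((w i - w j) * (w i - w j))) (fun i _ => Finset.sum_nonneg fun j _ => hnn i j)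
        (Finset.mem_univ i)
    refine le_trans (le_of_eq ?_) (h1.trans h2)
    rw [mul_pow, sq_abs]
    split_ifs <;> ring
  -- At time `s + k` the disagreement along present edges is small; moving both values back to time
  -- `s` costs two vanishing increments, as `k` is fixed.
  have h1 := ((hE.comp (tendsto_add_atTop_nat k)).add
    (tendsto_dac_add_sub hε hεc hc t₀ w₀ i k).abs).add
    (tendsto_dac_add_sub hε hεc hc t₀ w₀ j k).abs
  simp only [abs_zero, add_zero] at h1
  refine squeeze_zero (fun s => mul_nonneg (by split_ifs <;> norm_num) (abs_nonneg _))
    (fun s => ?_) h1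
  simp only [Function.comp_def]
  split_ifs
  · rw [one_mul, one_mul]
    have := abs_sub_abs_le_abs_sub (dac ε G t₀ w₀ s i - dac ε G t₀ w₀ s j)
      (dac ε G t₀ w₀ (s + k) i - dac ε G t₀ w₀ (s + k) j)
    have h2 : dac ε G t₀ w₀ s i - dac ε G t₀ w₀ s j
      - (dac ε G t₀ w₀ (s + k) i - dac ε G t₀ w₀ (s + k) j)
      = (dac ε G t₀ w₀ (s + k) j - dac ε G t₀ w₀ s j)
        - (dac ε G t₀ w₀ (s + k) i - dac ε G t₀ w₀ s i) := by ring
    rw [h2] at this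
    linarith [abs_sub (dac ε G t₀ w₀ (s + k) j - dac ε G t₀ w₀ s j)
        (dac ε G t₀ w₀ (s + k) i - dac ε G t₀ w₀ s i)]
  · rw [zero_mul, zero_mul, zero_add]
    exact add_nonneg (abs_nonneg _) (abs_nonneg _)

/-- Triangle inequality along a path, which has fewer than `|V|` edges. -/
theorem abs_sub_le_of_connected {g : SimpleGraph V} (hg : g.Connected) {w : V → ℝ} {B : ℝ}
    (hB0 : 0 ≤ B) (hB : ∀ i j, g.Adj i j → |w i - w j| ≤ B) (i j : V) :
    |w i - w j| ≤ Fintype.card V * B := by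
  classical
  have hwalk : ∀ {i j : V} (p : g.Walk i j), |w i - w j| ≤ p.length * B := by
    intro i j p
    induction p with
    | nil => simp
    | @cons a b d h p ih =>
      have := hB _ _ h
      rw [SimpleGraph.Walk.length_cons, Nat.cast_add, Nat.cast_one]
      have h2 := abs_sub_le (w a) (w b) (w d)
      refine h2.trans ?_
      linarith
  obtain ⟨p, hp⟩ := (hg i j).exists_isPath
  refine (hwalk p).trans (mul_le_mul_of_nonneg_right ?_ hB0)
  exact_mod_cast hp.length_lt.le

/-- Average consensus over a repeatedly connected network. -/
theorem tendsto_dac {ε c : ℝ} (hε : 0 < ε) (hεc : ε * c < 2) {G : ℕ → SimpleGraph V}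
    (hc : ∀ t u, lapForm (G t) u u ≤ 2 * c * ∑ i, u i ^ 2) {γ : ℕ}
    (hγ : ∀ t : ℕ, (⨆ τ ∈ Finset.Ico (t * γ) ((t + 1) * γ), G τ).Connected)
    (hγ0 : 0 < γ) (t₀ : ℕ) (w₀ : V → ℝ) (i : V) :
    Tendsto (fun s => dac ε G t₀ w₀ s i) atTop (𝓝 ((∑ j, w₀ j) / Fintype.card V)) := by
  classical
  set w := dac ε G t₀ w₀
  -- Connectivity is assumed only on windows aligned to multiples of `γ`. Any `2γ` consecutive times
  -- contain such a window, whatever the starting time.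
  set B : ℕ → ℝ := fun s => ∑ k ∈ Finset.range (2 * γ), ∑ i, ∑ j,
    (if (G (t₀ + (s + k))).Adj i j then (1 : ℝ) else 0) * |w s i - w s j|
  have hB : Tendsto B atTop (𝓝 0) := by
    have := tendsto_finsetSum (Finset.range (2 * γ)) fun k _ =>
      tendsto_finsetSum Finset.univ fun i (_ : i ∈ Finset.univ) =>
        tendsto_finsetSum Finset.univ fun j (_ : j ∈ Finset.univ) =>
          tendsto_edge_sub hε hεc hc t₀ w₀ i j k
    simp only [Finset.sum_const_zero] at this
    exact this
  have hnn : ∀ s k i j, 0 ≤ (if (G (t₀ + (s + k))).Adj i j then (1 : ℝ) else 0)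
      * |w s i - w s j| := fun s k i j =>
    mul_nonneg (by split_ifs <;> norm_num) (abs_nonneg _)
  have hB0 : ∀ s, 0 ≤ B s := fun s => Finset.sum_nonneg fun k _ => Finset.sum_nonneg fun i _ =>
    Finset.sum_nonneg fun j _ => hnn s k i j
  have hdiff : ∀ s i j, |w s i - w s j| ≤ Fintype.card V * B s := by
    intro s
    -- The first aligned window beginning strictly after time `t₀ + s`.
    refine abs_sub_le_of_connected (hγ ((t₀ + s) / γ + 1)) (hB0 s) fun i j hij => ?_
    simp only [SimpleGraph.iSup_adj] at hij
    obtain ⟨τ, hτ, hadj⟩ := hij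
    rw [Finset.mem_Ico] at hτ
    have h1 : t₀ + s < ((t₀ + s) / γ + 1) * γ := by
      rw [add_mul, one_mul, mul_comm]; exact Nat.lt_mul_div_succ _ hγ0
    have h2 : (t₀ + s) / γ * γ ≤ t₀ + s := Nat.div_mul_le_self _ _
    have h3 : τ < (t₀ + s) / γ * γ + 2 * γ := by
      have : ((t₀ + s) / γ + 1 + 1) * γ = (t₀ + s) / γ * γ + 2 * γ := by ring
      omega
    obtain ⟨k, rfl⟩ : ∃ k, τ = t₀ + (s + k) := ⟨τ - (t₀ + s), by omega⟩
    have hk : k ∈ Finset.range (2 * γ) := Finset.mem_range.2 (by omega)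
    have e1 := Finset.single_le_sum (f := fun j => (if (G (t₀ + (s + k))).Adj i j then (1 : ℝ)
      else 0) * |w s i - w s j|) (fun j _ => hnn s k i j) (Finset.mem_univ j)
    have e2 := Finset.single_le_sum (f := fun i => ∑ j, (if (G (t₀ + (s + k))).Adj i j then (1 : ℝ)
      else 0) * |w s i - w s j|) (fun i _ => Finset.sum_nonneg fun j _ => hnn s k i j)
      (Finset.mem_univ i)
    have e3 := Finset.single_le_sum (f := fun k => ∑ i, ∑ j, (if (G (t₀ + (s + k))).Adj i j
      then (1 : ℝ) else 0) * |w s i - w s j|) (fun k _ => Finset.sum_nonneg fun i _ =>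
        Finset.sum_nonneg fun j _ => hnn s k i j) hk
    simp only [hadj, if_true, one_mul] at e1
    exact e1.trans (e2.trans e3)
  have hlim : ∀ j, Tendsto (fun s => w s i - w s j) atTop (𝓝 0) := by
    intro j
    refine squeeze_zero_norm (fun s => ?_) (by simpa using hB.const_mul (Fintype.card V : ℝ))
    exact hdiff s i j
  have hcard : (Fintype.card V : ℝ) ≠ 0 := by
    have : Nonempty V := ⟨i⟩
    exact_mod_cast Fintype.card_ne_zero
  -- The value at `i` is the preserved average plus the mean of its differences to all the other
  -- values.
  have hsum : Tendsto (fun s => (∑ j, w₀ j) / Fintype.card V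
      + (∑ j, (w s i - w s j)) / Fintype.card V) atTop (𝓝 ((∑ j, w₀ j) / Fintype.card V)) := by
    have := (tendsto_finsetSum Finset.univ fun j _ => hlim j).div_const (Fintype.card V : ℝ)
    simpa using this.const_add ((∑ j, w₀ j) / Fintype.card V)
  refine hsum.congr fun s => ?_
  rw [Finset.sum_sub_distrib, sum_dac]
  field_simp
  simp

end DAC

/-! ### The consensus among all agents -/

section Network

variable {M : ℕ}

theorem connected_iSup_subnetwork_univ {G : ℕ → SimpleGraph (Fin M)} {T : Finset ℕ}
    (h : (⨆ τ ∈ T, G τ).Connected) :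
    (⨆ τ ∈ T, subnetwork Finset.univ (G τ)).Connected := by
  have he : (⨆ τ ∈ T, subnetwork Finset.univ (G τ))
      = (⨆ τ ∈ T, G τ).comap (Equiv.subtypeUnivEquiv (Finset.mem_univ (α := Fin M))) := by
    ext i j
    simp [subnetwork, SimpleGraph.iSup_adj]
  rw [he]
  exact (SimpleGraph.Iso.comap (Equiv.subtypeUnivEquiv (Finset.mem_univ (α := Fin M)))
    _).connected_iff.2 h

theorem degree_subnetwork_le (V : Finset (Fin M)) (g : SimpleGraph (Fin M)) [DecidableRel g.Adj]
    (i : V) [Fintype ((subnetwork V g).neighborSet i)] :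
    (subnetwork V g).degree i ≤ g.degree i := by
  rw [← SimpleGraph.card_neighborFinset_eq_degree, ← SimpleGraph.card_neighborFinset_eq_degree]
  refine Finset.card_le_card_of_injOn Subtype.val (fun j hj => ?_) Subtype.val_injective.injOn
  have : (subnetwork V g).Adj i j := by simpa using hj
  simpa using (show g.Adj i j from this)

/-- Both step size conditions reduce to `ε c < 2` with a bound `c` uniform in time: `c = 2Δ` in the
first case, `c = M` in the second. -/
theorem exists_lapForm_bound {G : ℕ → SimpleGraph (Fin M)} [∀ t, DecidableRel (G t).Adj]
    {ε : ℝ} (hM : 0 < M)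
    (hstep : (∀ t, ε * ((G t).maxDegree : ℝ) < 1) ∨ ε < 2 / (M : ℝ)) (V : Finset (Fin M)) :
    ∃ c, ε * c < 2 ∧ ∀ t u, lapForm (subnetwork V (G t)) u u ≤ 2 * c * ∑ i, u i ^ 2 := by
  classical
  rcases hstep with h | h
  -- The degrees are bounded integers, so their supremum over time is attained and the strict
  -- inequality survives.
  · obtain ⟨t', ht'⟩ : ∃ t', ∀ t, (G t).maxDegree ≤ (G t').maxDegree := by
      have hb : BddAbove (Set.range fun t => (G t).maxDegree) := by
        refine ⟨M, ?_⟩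
        rintro _ ⟨t, rfl⟩
        refine SimpleGraph.maxDegree_le_of_forall_degree_le _ _ fun v => ?_
        have := (G t).degree_lt_card_verts v
        rw [Fintype.card_fin] at this
        exact this.le
      obtain ⟨t', ht'⟩ := Nat.sSup_mem (Set.range_nonempty _) hb
      refine ⟨t', fun t => ?_⟩
      have := le_csSup hb (Set.mem_range_self t)
      exact this.trans ht'.ge
    refine ⟨2 * (G t').maxDegree, by linarith [h t'], fun t u => ?_⟩
    refine lapForm_self_le_degree _ (fun i => ?_) u
    have h1 := degree_subnetwork_le V (G t) i
    have h2 : (G t).degree i ≤ (G t').maxDegree := ((G t).degree_le_maxDegree i).trans (ht' t)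
    exact_mod_cast h1.trans h2
  · have hM' : (0 : ℝ) < M := by exact_mod_cast hM
    refine ⟨M, by rwa [lt_div_iff₀ hM'] at h, fun t u => ?_⟩
    refine (lapForm_self_le_card _ u).trans ?_
    have h1 : Fintype.card V ≤ M := by simpa using Finset.card_le_univ V
    have h2 : (Fintype.card V : ℝ) ≤ M := by exact_mod_cast h1
    have h3 : 0 ≤ ∑ i, u i ^ 2 := Finset.sum_nonneg fun _ _ => sq_nonneg _
    nlinarith

theorem RepeatedlyConnected.pos {G : ℕ → SimpleGraph (Fin M)} (hG : RepeatedlyConnected G) :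
    0 < M := by
  obtain ⟨γ, _, h⟩ := hG
  obtain ⟨i⟩ := (h 0).nonempty
  exact i.pos

theorem tendsto_dac_univ {G : ℕ → SimpleGraph (Fin M)} [∀ t, DecidableRel (G t).Adj]
    (hG : RepeatedlyConnected G) {ε : ℝ} (hε : 0 < ε)
    (hstep : (∀ t, ε * ((G t).maxDegree : ℝ) < 1) ∨ ε < 2 / (M : ℝ)) {V : Finset (Fin M)}
    (hV : V = Finset.univ) (t₀ : ℕ) (w₀ : V → ℝ) (i : V) :
    Tendsto (fun s => dac ε (fun t => subnetwork V (G t)) t₀ w₀ s i) atTop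
      (𝓝 ((∑ j, w₀ j) / (V.card : ℝ))) := by
  subst hV
  obtain ⟨c, hc, hb⟩ := exists_lapForm_bound hG.pos hstep Finset.univ
  obtain ⟨γ, hγ0, hγ⟩ := hG
  have := tendsto_dac hε hc hb (fun t => connected_iSup_subnetwork_univ (hγ t)) hγ0 t₀ w₀ i
  simpa using this

end Network

/-! ### The limits of the consensus-based predictions -/

section Limits

variable {M D n : ℕ} (θ : Hyper D) (d : Design M D n) (lead : Option (Fin M)) (x : Input D)

/-- The aggregated precision of all agents. -/
def aggPrec : ℝ :=
  ∑ j, beta θ d lead x j * (varOn θ d (augData d j) x)⁻¹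
    + (1 - ∑ j, beta θ d lead x j) * (varOn θ d (commData d) x)⁻¹

/-- The aggregated mean of all agents. -/
def aggMean (y : Fin M × Fin n → ℝ) : ℝ :=
  (aggPrec θ d lead x)⁻¹ *
    (∑ j, beta θ d lead x j * (varOn θ d (augData d j) x)⁻¹ * meanOn θ d y (augData d j) x
      - (∑ j, beta θ d lead x j - 1) * (varOn θ d (commData d) x)⁻¹
        * meanOn θ d y (commData d) x)

variable {θ d lead x}

theorem returns_agg {G : ℕ → SimpleGraph (Fin M)} [∀ t, DecidableRel (G t).Adj]
    (hG : RepeatedlyConnected G) {ε η : ℝ} (hε : 0 < ε)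
    (hstep : (∀ t, ε * ((G t).maxDegree : ℝ) < 1) ∨ ε < 2 / (M : ℝ))
    (hV : selected θ d η x = Finset.univ) (hprec : aggPrec θ d lead x ≠ 0)
    (y : Fin M × Fin n → ℝ) :
    Returns θ d y lead ε η G x (aggMean θ d lead x y) (aggPrec θ d lead x)⁻¹ := by
  rw [Returns]
  -- Agents are elements of a subtype of the selected set, so the set must become a variable before
  -- it can be replaced by `Finset.univ`.
  generalize selected θ d η x = V at hV
  have hM := hG.pos
  have hdac := fun t₀ w₀ i => tendsto_dac_univ hG hε hstep hV t₀ w₀ i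
  subst hV
  have hcard : ((Finset.univ : Finset (Fin M)).card : ℝ) ≠ 0 := by simpa using hM.ne'
  have hdac' : ∀ t₀ (w : Fin M → ℝ) (i : (Finset.univ : Finset (Fin M))),
      Tendsto (fun s => ((Finset.univ : Finset (Fin M)).card : ℝ) *
        dac ε (fun t => subnetwork Finset.univ (G t)) t₀ (fun j => w j) s i) atTop
        (𝓝 (∑ j, w j)) := by
    intro t₀ w i
    have := (hdac t₀ (fun j => w j) i).const_mul ((Finset.univ : Finset (Fin M)).card : ℝ)
    rwa [mul_div_cancel₀ _ hcard, Finset.sum_coe_sort Finset.univ w] at this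
  refine ⟨⟨⟨0, hM⟩, Finset.mem_univ _⟩, fun t₀ i => ?_⟩
  have hβ := hdac' t₀ (fun j => beta θ d lead x j) i
  have hP : Tendsto (fun s => decPrec θ d lead ε G Finset.univ x t₀ s i) atTop
      (𝓝 (aggPrec θ d lead x)) :=
    (hdac' t₀ (fun j => beta θ d lead x j * (varOn θ d (augData d j) x)⁻¹) i).add
      ((hβ.const_sub 1).mul_const _)
  refine ⟨?_, hP.inv₀ hprec⟩
  exact (hP.inv₀ hprec).mul ((hdac' t₀ (fun j => beta θ d lead x j
    * (varOn θ d (augData d j) x)⁻¹ * meanOn θ d y (augData d j) x) i).sub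
    (((hβ.sub_const 1).mul_const _).mul_const _))

end Limits

/-! ### Infill -/

theorem card_localData {M D n : ℕ} (d : Design M D n) (i : Fin M) :
    Fintype.card (localData d i) = n := by
  rw [Fintype.card_coe]
  have : localData d i = Finset.univ.image (Prod.mk i) := by
    ext ⟨a, b⟩
    simp [localData, eq_comm]
  rw [this, Finset.card_image_of_injective _ (Prod.mk_right_injective i), Finset.card_fin]

/-- Infill promises only one input near each point. A small ball around `u` contains `k` distinct
points of `U`, and inputs close enough to these carry distinct labels. -/
theorem exists_labels_near {M D : ℕ} {d : (n : ℕ) → Design M D n} {i : Fin M}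
    {U : Set (Input D)} (hU : IsOpen U)
    (hfill : ∀ x ∈ U, ∀ r > 0, ∀ᶠ n in atTop, ∃ j : Fin n, dist ((d n).X (i, j)) x < r)
    {u : Input D} (hu : u ∈ U) {r : ℝ} (hr : 0 < r) (k : ℕ) :
    ∀ᶠ n in atTop, ∃ s : Finset (localData (d n) i),
      s.card = k ∧ ∀ a ∈ s, dist ((d n).X a) u < r := by
  classical
  -- For `D = 0` there is a single input location, so distinct nearby points do not exist; any `k`
  -- of the `n` labels serve.
  rcases subsingleton_or_nontrivial (Input D) with hss | hnt
  · filter_upwards [eventually_ge_atTop k] with n hn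
    obtain ⟨s, -, hs⟩ := Finset.exists_subset_card_eq
      (s := (Finset.univ : Finset (localData (d n) i)))
      (n := k) (by rwa [Finset.card_univ, card_localData])
    refine ⟨s, hs, fun a _ => ?_⟩
    rwa [Subsingleton.elim ((d n).X a) u, dist_self]
  · have := Module.punctured_nhds_neBot ℝ (Input D) u
    have hinf : (U ∩ Metric.ball u (r / 2)).Infinite :=
      infinite_of_mem_nhds u (inter_mem (hU.mem_nhds hu) (Metric.ball_mem_nhds _ (by positivity)))
    obtain ⟨Z, hZU, hZ⟩ := hinf.exists_subset_card_eq k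
    obtain ⟨ρ, hρ0, hρr, hρ⟩ : ∃ ρ > 0, ρ < r / 2 ∧
        ∀ z ∈ Z, ∀ z' ∈ Z, z ≠ z' → ρ < dist z z' / 2 := by
      have h1 : ∀ᶠ ρ : ℝ in 𝓝[>] 0, ∀ z ∈ Z, ∀ z' ∈ Z, z ≠ z' → ρ < dist z z' / 2 := by
        rw [Filter.eventually_all_finset]
        intro z _
        rw [Filter.eventually_all_finset]
        intro z' _
        by_cases hzz : z = z'
        · simp [hzz]
        · have : 0 < dist z z' / 2 := half_pos (dist_pos.2 hzz)
          filter_upwards [nhdsWithin_le_nhds (gt_mem_nhds this)] with ρ hρ _ using hρ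
      have h2 : ∀ᶠ ρ : ℝ in 𝓝[>] 0, ρ < r / 2 := nhdsWithin_le_nhds (gt_mem_nhds (half_pos hr))
      have h3 : ∀ᶠ ρ : ℝ in 𝓝[>] 0, 0 < ρ := eventually_mem_nhdsWithin
      obtain ⟨ρ, h, h', h''⟩ := (h3.and (h2.and h1)).exists
      exact ⟨ρ, h, h', h''⟩
    have hev : ∀ᶠ n in atTop, ∀ z ∈ Z, ∃ j : Fin n, dist ((d n).X (i, j)) z < ρ := by
      rw [Filter.eventually_all_finset]
      exact fun z hz => hfill z (hZU hz).1 ρ hρ0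
    filter_upwards [hev] with n hn
    choose j hj using hn
    refine ⟨Z.attach.image fun z => ⟨(i, j z.1 z.2), by simp [localData]⟩, ?_, ?_⟩
    · rw [Finset.card_image_of_injOn, Finset.card_attach, hZ]
      rintro ⟨z, hz⟩ - ⟨z', hz'⟩ - h
      have h : j z hz = j z' hz' := congrArg (fun p => p.1.2) h
      by_contra hne
      have h1 := hj z hz
      have h2 := hj z' hz'
      rw [← h] at h2
      have h3 := hρ z hz z' hz' fun h => hne (Subtype.ext h)
      have h4 := dist_triangle_left z z' ((d n).X (i, j z hz))
      linarith
    · intro a ha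
      obtain ⟨⟨z, hz⟩, -, rfl⟩ := Finset.mem_image.1 ha
      have h1 := hj z hz
      have h2 := (hZU hz).2
      rw [Metric.mem_ball] at h2
      have h3 := dist_triangle ((d n).X (i, j z hz)) z u
      change dist ((d n).X (i, j z hz)) u < r
      linarith

/-! ### Bounds for the aggregation -/

/-- Here `a = σ_c²` and `b = σ_{+i}²`. If `a ≥ 4b`, then `β ≥ 1/2` (as `log 2 > 1/2`) and `b⁻¹ - a⁻¹
≥ (3/4) b⁻¹`, so the increment in `p` dominates both `b⁻¹` and `β b⁻¹`, however large `β` is. If `a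
≤ 4b`, then `β ≤ 1` and `b⁻¹ ≤ 4a⁻¹ ≤ 4p`. -/
theorem agg_single_bound {a b β p : ℝ} (hb : 0 < b) (hba : b ≤ a)
    (hβ : β = 1 ∨ β = 1 / 2 * (Real.log a - Real.log b)) (hp : a⁻¹ + β * (b⁻¹ - a⁻¹) ≤ p) :
    0 ≤ β ∧ p⁻¹ ≤ 4 * b ∧ p⁻¹ * (β * b⁻¹) ≤ 4 := by
  have ha : 0 < a := hb.trans_le hba
  have hlog : Real.log a - Real.log b = Real.log (a / b) := (Real.log_div ha.ne' hb.ne').symm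
  have hβ0 : 0 ≤ β := by
    rcases hβ with rfl | rfl
    · norm_num
    · have := Real.log_le_log hb hba
      linarith
  have hinv : a⁻¹ ≤ b⁻¹ := inv_anti₀ hb hba
  have ha' : 0 < a⁻¹ := inv_pos.2 ha
  have hb' : 0 < b⁻¹ := inv_pos.2 hb
  have hpa : a⁻¹ ≤ p := by nlinarith
  have hp0 : 0 < p := ha'.trans_le hpa
  have hlog4 : Real.log 4 = 2 * Real.log 2 := by
    rw [show (4 : ℝ) = 2 ^ 2 by norm_num, Real.log_pow]; norm_num
  have h2 := Real.log_two_gt_d9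
  have h2' := Real.log_two_lt_d9
  have key : b⁻¹ ≤ 4 * p ∧ β * b⁻¹ ≤ 4 * p := by
    rcases le_total (4 * b) a with h | h
    · have hβ1 : 1 / 2 ≤ β := by
        rcases hβ with rfl | rfl
        · norm_num
        · have h4 : (4 : ℝ) ≤ a / b := by rwa [le_div_iff₀ hb]
          have := Real.log_le_log (by norm_num) h4
          rw [hlog]; linarith
      have h5 : 4 * a⁻¹ ≤ b⁻¹ := by
        have := inv_anti₀ (by positivity : 0 < 4 * b) h
        rw [mul_inv] at this
        linarith
      constructor <;> nlinarith
    · have hβ1 : β ≤ 1 := by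
        rcases hβ with rfl | rfl
        · norm_num
        · have h4 : a / b ≤ 4 := by rwa [div_le_iff₀ hb]
          have := Real.log_le_log (by positivity) h4
          rw [hlog]; linarith
      have h5 : b⁻¹ ≤ 4 * a⁻¹ := by
        have := inv_anti₀ ha h
        rw [mul_inv] at this
        linarith
      constructor <;> nlinarith
  refine ⟨hβ0, ?_, ?_⟩
  · rw [inv_le_comm₀ hp0 (by positivity), mul_inv]
    linarith [key.1]
  · rw [inv_mul_le_iff₀ hp0]; linarith [key.2]

/-! ### The probabilistic model as vectors in `L²` -/

section Probability

variable {Ω : Type*} [MeasurableSpace Ω] {P : Measure Ω}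

theorem inner_toLp {f g : Ω → ℝ} (hf : MemLp f 2 P) (hg : MemLp g 2 P) :
    inner ℝ (hf.toLp f) (hg.toLp g) = ∫ ω, (f * g) ω ∂P := by
  rw [L2.inner_def]
  refine integral_congr_ae ?_
  filter_upwards [hf.coeFn_toLp, hg.coeFn_toLp] with ω h1 h2
  rw [h1, h2]
  simp [mul_comm]

theorem inner_toLp_eq_covariance [IsProbabilityMeasure P] {f g : Ω → ℝ} (hf : MemLp f 2 P)
    (hg : MemLp g 2 P) (h0 : ∫ ω, f ω ∂P = 0) :
    inner ℝ (hf.toLp f) (hg.toLp g) = covariance f g P := by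
  rw [inner_toLp, covariance_eq_sub hf hg, h0, zero_mul, sub_zero]

theorem coeFn_sum_smul_toLp {ι : Type*} (s : Finset ι) (c : ι → ℝ) {g : ι → Ω → ℝ}
    (hg : ∀ a, MemLp (g a) 2 P) :
    ⇑(∑ a ∈ s, c a • (hg a).toLp (g a)) =ᵐ[P] fun ω => ∑ a ∈ s, c a * g a ω := by
  classical
  induction s using Finset.induction_on with
  | empty =>
    simp only [Finset.sum_empty]
    exact Lp.coeFn_zero _ _ _
  | insert b s hb ih =>
    simp only [Finset.sum_insert hb]
    filter_upwards [Lp.coeFn_add (c b • (hg b).toLp (g b)) (∑ a ∈ s, c a • (hg a).toLp (g a)),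
      Lp.coeFn_smul (c b) ((hg b).toLp (g b)), (hg b).coeFn_toLp, ih] with ω h1 h2 h3 h4
    rw [h1, Pi.add_apply, h2, Pi.smul_apply, h3, h4, smul_eq_mul]

variable {M D : ℕ} {θ : Hyper D} {f : Input D → Ω → ℝ} {e : (n : ℕ) → Fin M × Fin n → Ω → ℝ}

theorem Model.memLp_signal (h : Model P θ f e) (x : Input D) : MemLp (f x) 2 P :=
  (h.gaussian.hasGaussianLaw_eval x).memLp_two

theorem Model.memLp_noise (h : Model P θ f e) (n : ℕ) (p : Fin M × Fin n) :
    MemLp (e n p) 2 P :=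
  (h.noise_law n p).hasGaussianLaw.memLp_two

theorem Model.integral_noise (h : Model P θ f e) (n : ℕ) (p : Fin M × Fin n) :
    ∫ ω, e n p ω ∂P = 0 := by
  rw [(h.noise_law n p).integral_eq, integral_id_gaussianReal]

/-- For centred square-integrable variables the `L²` inner product is the covariance, and
independence makes it 0. -/
theorem Model.realizes [IsProbabilityMeasure P] (h : Model P θ f e) (n : ℕ) :
    Realizes θ (fun x => (h.memLp_signal x).toLp (f x))
      (fun p => (h.memLp_noise n p).toLp (e n p)) where
  inner_signal x x' := by
    rw [inner_toLp_eq_covariance _ _ (h.mean_zero x), h.cov_eq]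
  inner_noise_self p := by
    rw [inner_toLp_eq_covariance _ _ (h.integral_noise n p),
      covariance_self (h.noise_law n p).aemeasurable, (h.noise_law n p).variance_eq,
      variance_id_gaussianReal, Real.coe_toNNReal _ (sq_nonneg _)]
  inner_noise_ne p q hpq := by
    rw [inner_toLp_eq_covariance _ _ (h.integral_noise n p)]
    exact ((h.noise_indep n).indepFun hpq).covariance_eq_zero (h.memLp_noise n p)
      (h.memLp_noise n q)
  inner_signal_noise x p := by
    rw [inner_toLp_eq_covariance _ _ (h.mean_zero x)]
    exact ((h.noise_indep_f n).comp (measurable_pi_apply x)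
      (measurable_pi_apply p)).covariance_eq_zero (h.memLp_signal x) (h.memLp_noise n p)

theorem Model.memLp_outputs (h : Model P θ f e) {n : ℕ} (d : Design M D n) (p : Fin M × Fin n) :
    MemLp (fun ω => outputs d f (e n) ω p) 2 P :=
  (h.memLp_signal (d.X p)).add (h.memLp_noise n p)

theorem Model.memLp_gpMean (h : Model P θ f e) {n : ℕ} (d : Design M D n) {κ : Type} [Fintype κ]
    [DecidableEq κ] (g : κ → Fin M × Fin n) (x : Input D) :
    MemLp (fun ω => gpMean θ (fun k => d.X (g k)) (fun k => outputs d f (e n) ω (g k)) x) 2 P := by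
  simp only [gpMean_eq_sum]
  exact memLp_finsetSum _ fun k _ => (h.memLp_outputs d (g k)).const_mul _

/-- The mean-square error of the prediction mean is the prediction variance. -/
theorem Model.eLpNorm_sub_gpMean [IsProbabilityMeasure P] (h : Model P θ f e) {n : ℕ}
    (d : Design M D n) {κ : Type} [Fintype κ] [DecidableEq κ] {g : κ → Fin M × Fin n}
    (hg : Function.Injective g) (x : Input D) :
    eLpNorm (fun ω => f x ω
      - gpMean θ (fun k => d.X (g k)) (fun k => outputs d f (e n) ω (g k)) x) 2 P
      = ENNReal.ofReal √(gpVar θ (fun k => d.X (g k)) x) := by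
  rw [← ((h.realizes n).comp g hg).norm_sq_residual (fun k => d.X (g k)) x,
    Real.sqrt_sq (norm_nonneg _), Lp.norm_def, ENNReal.ofReal_toReal (Lp.eLpNorm_ne_top _)]
  refine eLpNorm_congr_ae ?_
  have h1 := coeFn_sum_smul_toLp Finset.univ (weights θ (fun k => d.X (g k)) x)
    (fun k => h.memLp_outputs d (g k))
  have h2 : ∀ k, (h.memLp_outputs d (g k)).toLp _ = (h.memLp_signal (d.X (g k))).toLp _
      + (h.memLp_noise n (g k)).toLp _ := fun k => MemLp.toLp_add _ _
  simp only [h2] at h1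
  filter_upwards [h1, (h.memLp_signal x).coeFn_toLp,
    Lp.coeFn_sub ((h.memLp_signal x).toLp (f x))
      (∑ k, weights θ (fun k => d.X (g k)) x k • ((h.memLp_signal (d.X (g k))).toLp _
        + (h.memLp_noise n (g k)).toLp _))] with ω h3 h4 h5
  rw [h5, Pi.sub_apply, h3, h4, gpMean_eq_sum]

variable {n : ℕ} (d : Design M D n)

theorem Model.varOn_pos [IsProbabilityMeasure P] (h : Model P θ f e)
    (S : Finset (Fin M × Fin n)) (x : Input D) : 0 < varOn θ d S x :=
  ((h.realizes n).comp (Subtype.val : S → _) Subtype.val_injective).gpVar_pos (fun p : S => d.X p) x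

theorem Model.varOn_anti [IsProbabilityMeasure P] (h : Model P θ f e)
    {S T : Finset (Fin M × Fin n)} (hST : S ⊆ T) (x : Input D) :
    varOn θ d T x ≤ varOn θ d S x :=
  ((h.realizes n).comp (Subtype.val : T → _) Subtype.val_injective).gpVar_le_comp
    (X := fun p : T => d.X p) (fun p : S => ⟨p.1, hST p.2⟩)
    (fun p q hpq => Subtype.ext (by simpa using hpq)) x

theorem Model.gpVar_full_le [IsProbabilityMeasure P] (h : Model P θ f e)
    (S : Finset (Fin M × Fin n)) (x : Input D) : gpVar θ d.X x ≤ varOn θ d S x :=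
  (h.realizes n).gpVar_le_comp (X := d.X) (Subtype.val : S → _) Subtype.val_injective x

theorem Model.tendsto_varOn_localData [IsProbabilityMeasure P] (h : Model P θ f e)
    {d : (n : ℕ) → Design M D n} (hinfill : Infill d) (i : Fin M) (x : Input D) :
    Tendsto (fun n => varOn θ (d n) (localData (d n) i) x) atTop (𝓝 0) := by
  obtain ⟨U, hU, hne, hfill⟩ := hinfill i
  exact tendsto_gpVar_zero
    (fun n => (h.realizes n).comp (Subtype.val : localData (d n) i → _) Subtype.val_injective)
    (fun n p => (d n).X p) hU hne
    (fun u hu r hr k => exists_labels_near hU hfill hu hr k) x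

/-- `crossCov` is `σ_f²` minus the local variance, so it tends to `σ_f² > η`; there are finitely
many agents. -/
theorem Model.eventually_selected_eq_univ [IsProbabilityMeasure P] (h : Model P θ f e)
    {d : (n : ℕ) → Design M D n} (hinfill : Infill d) {η : ℝ} (hη : η < θ.sigF ^ 2)
    (x : Input D) : ∀ᶠ n in atTop, selected θ (d n) η x = Finset.univ := by
  have : ∀ᶠ n in atTop, ∀ i, varOn θ (d n) (localData (d n) i) x < θ.sigF ^ 2 - η :=
    eventually_all.2 fun i =>
      (h.tendsto_varOn_localData hinfill i x).eventually (gt_mem_nhds (by linarith))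
  filter_upwards [this] with n hn
  rw [selected, Finset.filter_eq_self]
  intro i _
  have := hn i
  rw [varOn, gpVar, kernel_self] at this
  linarith

/-! ### Error bounds for the aggregated prediction -/

variable (lead : Option (Fin M)) (x : Input D)

theorem beta_cases (i : Fin M) : beta θ d lead x i = 1 ∨ beta θ d lead x i
    = 1 / 2 * (Real.log (varOn θ d (commData d) x) - Real.log (varOn θ d (augData d i) x)) := by
  rw [beta]; split_ifs <;> simp

/-- In this form the precision is `σ_c⁻²` plus nonnegative increments, whence its positivity and a
lower bound by each single agent's term. -/
theorem aggPrec_eq : aggPrec θ d lead x = (varOn θ d (commData d) x)⁻¹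
    + ∑ i, beta θ d lead x i
      * ((varOn θ d (augData d i) x)⁻¹ - (varOn θ d (commData d) x)⁻¹) := by
  rw [aggPrec]
  simp only [mul_sub, Finset.sum_sub_distrib, ← Finset.sum_mul]
  ring

theorem Model.varOn_augData_le [IsProbabilityMeasure P] (h : Model P θ f e) (i : Fin M) :
    varOn θ d (augData d i) x ≤ varOn θ d (commData d) x :=
  h.varOn_anti d Finset.subset_union_right x

theorem Model.beta_nonneg [IsProbabilityMeasure P] (h : Model P θ f e) (i : Fin M) :
    0 ≤ beta θ d lead x i :=
  (agg_single_bound (h.varOn_pos d _ x) (h.varOn_augData_le d x i) (beta_cases d lead x i)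
    le_rfl).1

theorem Model.aggPrec_ge [IsProbabilityMeasure P] (h : Model P θ f e) (i : Fin M) :
    (varOn θ d (commData d) x)⁻¹ + beta θ d lead x i
      * ((varOn θ d (augData d i) x)⁻¹ - (varOn θ d (commData d) x)⁻¹)
      ≤ aggPrec θ d lead x := by
  rw [aggPrec_eq]
  gcongr
  refine Finset.single_le_sum (f := fun i => beta θ d lead x i
      * ((varOn θ d (augData d i) x)⁻¹ - (varOn θ d (commData d) x)⁻¹)) (fun j _ => ?_)
      (Finset.mem_univ i)
  exact mul_nonneg (h.beta_nonneg d lead x j)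
    (sub_nonneg.2 (inv_anti₀ (h.varOn_pos d _ x) (h.varOn_augData_le d x j)))

theorem Model.aggPrec_pos [IsProbabilityMeasure P] (h : Model P θ f e) :
    0 < aggPrec θ d lead x := by
  rw [aggPrec_eq]
  refine add_pos_of_pos_of_nonneg (inv_pos.2 (h.varOn_pos d _ x)) (Finset.sum_nonneg fun j _ => ?_)
  exact mul_nonneg (h.beta_nonneg d lead x j)
    (sub_nonneg.2 (inv_anti₀ (h.varOn_pos d _ x) (h.varOn_augData_le d x j)))

theorem Model.agg_bounds [IsProbabilityMeasure P] (h : Model P θ f e) (i : Fin M) :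
    (aggPrec θ d lead x)⁻¹ ≤ 4 * varOn θ d (augData d i) x ∧
    (aggPrec θ d lead x)⁻¹ * (beta θ d lead x i * (varOn θ d (augData d i) x)⁻¹) ≤ 4 :=
  (agg_single_bound (h.varOn_pos d _ x) (h.varOn_augData_le d x i) (beta_cases d lead x i)
    (h.aggPrec_ge d lead x i)).2

/-- The weight of the communication dataset, times its prediction standard deviation. -/
theorem Model.comm_weight_le [IsProbabilityMeasure P] (h : Model P θ f e) (hM : 0 < M) :
    |(aggPrec θ d lead x)⁻¹ * ((1 - ∑ i, beta θ d lead x i) * (varOn θ d (commData d) x)⁻¹)|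
      * √(varOn θ d (commData d) x) ≤ 8 * ∑ i, √(varOn θ d (augData d i) x) := by
  set p := aggPrec θ d lead x
  set a := varOn θ d (commData d) x
  have hp : 0 < p := h.aggPrec_pos d lead x
  have ha : 0 < a := h.varOn_pos d _ x
  have hb : ∀ i, 0 < varOn θ d (augData d i) x := fun i => h.varOn_pos d _ x
  -- `v⁻¹ √v = 1/√v` decreases in `v`. This trades the deviation `√a`, which need not vanish, for
  -- the deviations of the larger datasets.
  have hinv : ∀ i, a⁻¹ * √a ≤ (varOn θ d (augData d i) x)⁻¹ * √(varOn θ d (augData d i) x) := by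
    intro i
    rw [inv_mul_eq_div, inv_mul_eq_div, Real.sqrt_div_self', Real.sqrt_div_self']
    exact one_div_le_one_div_of_le (Real.sqrt_pos.2 (hb i))
      (Real.sqrt_le_sqrt (h.varOn_augData_le d x i))
  have hβ0 : 0 ≤ ∑ i, beta θ d lead x i := Finset.sum_nonneg fun i _ => h.beta_nonneg d lead x i
  have h1 : |1 - ∑ i, beta θ d lead x i| ≤ 1 + ∑ i, beta θ d lead x i := by
    rw [abs_le]; constructor <;> linarith
  have hsq : ∀ i, varOn θ d (augData d i) x
      * ((varOn θ d (augData d i) x)⁻¹ * √(varOn θ d (augData d i) x))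
      = √(varOn θ d (augData d i) x) := fun i => mul_inv_cancel_left₀ (hb i).ne' _
  have hterm : ∀ i, p⁻¹ * beta θ d lead x i * (a⁻¹ * √a) ≤ 4 * √(varOn θ d (augData d i) x) := by
    intro i
    have h2 := (h.agg_bounds d lead x i).2
    calc _ ≤ p⁻¹ * beta θ d lead x i * ((varOn θ d (augData d i) x)⁻¹
        * √(varOn θ d (augData d i) x)) :=
          mul_le_mul_of_nonneg_left (hinv i)
            (mul_nonneg (inv_pos.2 hp).le (h.beta_nonneg d lead x i))
      _ = (p⁻¹ * (beta θ d lead x i * (varOn θ d (augData d i) x)⁻¹))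
        * √(varOn θ d (augData d i) x) := by ring
      _ ≤ _ := mul_le_mul_of_nonneg_right h2 (Real.sqrt_nonneg _)
  -- The term 1 of `1 + ∑ β` costs one factor 4, through any one agent; the sum costs the other,
  -- giving 8.
  have hfirst : p⁻¹ * (a⁻¹ * √a) ≤ 4 * ∑ i, √(varOn θ d (augData d i) x) := by
    have h2 := (h.agg_bounds d lead x ⟨0, hM⟩).1
    have h3 := Finset.single_le_sum (f := fun i => √(varOn θ d (augData d i) x))
      (fun i _ => Real.sqrt_nonneg _) (Finset.mem_univ (⟨0, hM⟩ : Fin M))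
    calc _ ≤ (4 * varOn θ d (augData d ⟨0, hM⟩) x) * ((varOn θ d (augData d ⟨0, hM⟩) x)⁻¹
        * √(varOn θ d (augData d ⟨0, hM⟩) x)) :=
          mul_le_mul h2 (hinv _) (by positivity) (by have := hb ⟨0, hM⟩; positivity)
      _ = 4 * √(varOn θ d (augData d ⟨0, hM⟩) x) := by rw [mul_assoc, hsq]
      _ ≤ _ := mul_le_mul_of_nonneg_left h3 (by norm_num)
  have hsum : p⁻¹ * (∑ i, beta θ d lead x i) * (a⁻¹ * √a)
      ≤ 4 * ∑ i, √(varOn θ d (augData d i) x) := by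
    rw [Finset.mul_sum, Finset.sum_mul, Finset.mul_sum]
    exact Finset.sum_le_sum fun i _ => hterm i
  rw [abs_mul, abs_mul, abs_of_pos (inv_pos.2 hp), abs_of_pos (inv_pos.2 ha)]
  have h4 : p⁻¹ * (|1 - ∑ i, beta θ d lead x i| * a⁻¹) * √a
      ≤ p⁻¹ * ((1 + ∑ i, beta θ d lead x i) * a⁻¹) * √a := by gcongr
  nlinarith

/-- The mean-square distance of the full and the aggregated prediction mean. -/
theorem Model.eLpNorm_gpMean_sub_aggMean_le [IsProbabilityMeasure P] (h : Model P θ f e)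
    (hM : 0 < M) :
    eLpNorm (fun ω => gpMean θ d.X (outputs d f (e n) ω) x
      - aggMean θ d lead x (outputs d f (e n) ω)) 2 P
      ≤ ENNReal.ofReal (√(gpVar θ d.X x) + 12 * ∑ i, √(varOn θ d (augData d i) x)) := by
  set p := aggPrec θ d lead x with hp_def
  have hp : 0 < p := h.aggPrec_pos d lead x
  set q : Fin M → ℝ := fun i => p⁻¹ * (beta θ d lead x i * (varOn θ d (augData d i) x)⁻¹) with hq
  set c := p⁻¹ * ((1 - ∑ i, beta θ d lead x i) * (varOn θ d (commData d) x)⁻¹) with hc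
  -- Because the coefficients sum to 1, `f x` cancels and the aggregate error is the same
  -- combination of the individual errors; `c` may be negative.
  have hone : ∑ i, q i + c = 1 := by
    rw [hq, hc, ← Finset.mul_sum, ← mul_add]
    exact inv_mul_cancel₀ hp.ne'
  have hq0 : ∀ i, 0 ≤ q i := fun i => mul_nonneg (inv_pos.2 hp).le
    (mul_nonneg (h.beta_nonneg d lead x i) (inv_pos.2 (h.varOn_pos d _ x)).le)
  set E : Finset (Fin M × Fin n) → Ω → ℝ := fun S ω =>
    f x ω - meanOn θ d (outputs d f (e n) ω) S x with hE
  set E₀ : Ω → ℝ := fun ω => f x ω - gpMean θ d.X (outputs d f (e n) ω) x with hE₀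
  have hEn : ∀ S, eLpNorm (E S) 2 P = ENNReal.ofReal √(varOn θ d S x) := fun S =>
    h.eLpNorm_sub_gpMean d (g := (Subtype.val : S → _)) Subtype.val_injective x
  have hE₀n : eLpNorm E₀ 2 P = ENNReal.ofReal √(gpVar θ d.X x) :=
    h.eLpNorm_sub_gpMean d (g := id) Function.injective_id x
  have hEm : ∀ S, AEStronglyMeasurable (E S) P := fun S =>
    ((h.memLp_signal x).sub (h.memLp_gpMean d (Subtype.val : S → _) x)).aestronglyMeasurable
  have hE₀m : AEStronglyMeasurable E₀ P :=
    ((h.memLp_signal x).sub (h.memLp_gpMean d id x)).aestronglyMeasurable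
  have hdecomp : (fun ω => gpMean θ d.X (outputs d f (e n) ω) x
      - aggMean θ d lead x (outputs d f (e n) ω))
      = ((∑ i, q i • E (augData d i)) + c • E (commData d)) - E₀ := by
    funext ω
    simp only [Pi.sub_apply, Pi.add_apply, Finset.sum_apply, Pi.smul_apply, smul_eq_mul, hE, hE₀,
      mul_sub, Finset.sum_sub_distrib, ← Finset.sum_mul]
    have h1 : aggMean θ d lead x (outputs d f (e n) ω)
        = ∑ i, q i * meanOn θ d (outputs d f (e n) ω) (augData d i) x
          + c * meanOn θ d (outputs d f (e n) ω) (commData d) x := by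
      rw [aggMean, mul_sub, Finset.mul_sum, ← hp_def, hc]
      simp only [hq, mul_assoc]
      ring
    rw [h1]
    linear_combination (-f x ω) * hone
  rw [hdecomp]
  have hsm : ∀ (r : ℝ) S, eLpNorm (r • E S) 2 P = ENNReal.ofReal (|r| * √(varOn θ d S x)) := by
    intro r S
    rw [eLpNorm_const_smul, hEn, ENNReal.ofReal_mul (abs_nonneg _), Real.enorm_eq_ofReal_abs]
  have h1 : eLpNorm (∑ i, q i • E (augData d i)) 2 P
      ≤ ENNReal.ofReal (4 * ∑ i, √(varOn θ d (augData d i) x)) := by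
    refine (eLpNorm_sum_le (fun i _ => (hEm _).const_smul _) (by norm_num)).trans ?_
    rw [Finset.mul_sum, ENNReal.ofReal_sum_of_nonneg fun i _ => by positivity]
    refine Finset.sum_le_sum fun i _ => ?_
    rw [hsm]
    refine ENNReal.ofReal_le_ofReal (mul_le_mul_of_nonneg_right ?_ (Real.sqrt_nonneg _))
    rw [abs_of_nonneg (hq0 i)]
    exact (h.agg_bounds d lead x i).2
  have h2 : eLpNorm (c • E (commData d)) 2 P
      ≤ ENNReal.ofReal (8 * ∑ i, √(varOn θ d (augData d i) x)) := by
    rw [hsm]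
    exact ENNReal.ofReal_le_ofReal (h.comm_weight_le d lead x hM)
  have hs0 : 0 ≤ ∑ i, √(varOn θ d (augData d i) x) :=
    Finset.sum_nonneg fun i _ => Real.sqrt_nonneg _
  have hsumm : AEStronglyMeasurable (∑ i, q i • E (augData d i)) P :=
    Finset.aestronglyMeasurable_sum _ fun i _ => (hEm _).const_smul _
  calc _ ≤ eLpNorm ((∑ i, q i • E (augData d i)) + c • E (commData d)) 2 P + eLpNorm E₀ 2 P :=
        eLpNorm_sub_le (hsumm.add ((hEm _).const_smul _)) hE₀m (by norm_num)
    _ ≤ (eLpNorm (∑ i, q i • E (augData d i)) 2 P + eLpNorm (c • E (commData d)) 2 P)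
        + eLpNorm E₀ 2 P := by
        gcongr
        exact eLpNorm_add_le hsumm ((hEm _).const_smul _) (by norm_num)
    _ ≤ (ENNReal.ofReal (4 * ∑ i, √(varOn θ d (augData d i) x))
        + ENNReal.ofReal (8 * ∑ i, √(varOn θ d (augData d i) x)))
        + ENNReal.ofReal √(gpVar θ d.X x) := by
        rw [hE₀n]; gcongr
    _ = _ := by
        rw [← ENNReal.ofReal_add (by positivity) (by positivity),
          ← ENNReal.ofReal_add (by positivity) (by positivity)]
        congr 1; ring

end Probability

end DecGP

end

/-! ### Assembly of the proposition. -/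

theorem mainTheorem6 {Ω : Type*} [MeasurableSpace Ω] (P : MeasureTheory.Measure Ω)
    [MeasureTheory.IsProbabilityMeasure P] {M D : ℕ}
    (θ : DecGP.Hyper D) (f : DecGP.Input D → Ω → ℝ) (e : (n : ℕ) → Fin M × Fin n → Ω → ℝ)
    (hmodel : DecGP.Model P θ f e)
    (d : (n : ℕ) → DecGP.Design M D n) (hinfill : DecGP.Infill d)
    (G : ℕ → SimpleGraph (Fin M)) [∀ t, DecidableRel (G t).Adj]
    (hG : DecGP.RepeatedlyConnected G)
    (ε : ℝ) (hε : 0 < ε)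
    (hstep : (∀ t, ε * ((G t).maxDegree : ℝ) < 1) ∨ ε < 2 / (M : ℝ))
    (η : ℝ) (hη : η < θ.sigF ^ 2) (lead : Option (Fin M)) :
    (∀ x, ∀ᶠ n in Filter.atTop, ∀ (t₀ : ℕ) (w₀ : DecGP.selected θ (d n) η x → ℝ)
        (i : DecGP.selected θ (d n) η x),
      Filter.Tendsto
        (fun s => DecGP.dac ε
          (fun t => DecGP.subnetwork (DecGP.selected θ (d n) η x) (G t)) t₀ w₀ s i)
        Filter.atTop
        (nhds ((∑ j, w₀ j) / ((DecGP.selected θ (d n) η x).card : ℝ)))) ∧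
    ∃ (μNN : ℕ → DecGP.Input D → Ω → ℝ) (vNN : ℕ → DecGP.Input D → ℝ),
      (∀ x, ∀ᶠ n in Filter.atTop, ∀ ω,
        DecGP.Returns θ (d n) (DecGP.outputs (d n) f (e n) ω) lead ε η G x
          (μNN n x ω) (vNN n x)) ∧
      DecGP.Consistent P
        (fun n x ω => DecGP.gpMean θ (d n).X (DecGP.outputs (d n) f (e n) ω) x) μNN
        (fun n x => DecGP.gpVar θ (d n).X x) vNN := by
  have hM := hG.pos
  -- The witnesses aggregate over all agents at every `n`; they need to agree with the method's
  -- limits only once all agents are selected.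
  refine ⟨fun x => ?_, fun n x ω => DecGP.aggMean θ (d n) lead x (DecGP.outputs (d n) f (e n) ω),
    fun n x => (DecGP.aggPrec θ (d n) lead x)⁻¹, fun x => ?_, fun x => ?_⟩
  · filter_upwards [hmodel.eventually_selected_eq_univ hinfill hη x] with n hn t₀ w₀ i
    exact DecGP.tendsto_dac_univ hG hε hstep hn t₀ w₀ i
  · filter_upwards [hmodel.eventually_selected_eq_univ hinfill hη x] with n hn ω
    exact DecGP.returns_agg hG hε hstep hn (hmodel.aggPrec_pos (d n) lead x).ne' _
  · have haug : ∀ i, Tendsto (fun n => DecGP.varOn θ (d n) (DecGP.augData (d n) i) x) atTop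
        (𝓝 0) := fun i =>
      squeeze_zero (fun n => (hmodel.varOn_pos (d n) _ x).le)
        (fun n => hmodel.varOn_anti (d n) Finset.subset_union_left x)
        (hmodel.tendsto_varOn_localData hinfill i x)
    have hfull : Tendsto (fun n => DecGP.gpVar θ (d n).X x) atTop (𝓝 0) :=
      squeeze_zero (fun n => ((hmodel.realizes n).gpVar_pos (d n).X x).le)
        (fun n => hmodel.gpVar_full_le (d n) _ x)
        (hmodel.tendsto_varOn_localData hinfill ⟨0, hM⟩ x)
    constructor
    · have hsqrt : ∀ {v : ℕ → ℝ}, Tendsto v atTop (𝓝 0) →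
          Tendsto (fun n => √(v n)) atTop (𝓝 0) := fun hv => by simpa using hv.sqrt
      have hlim := (hsqrt hfull).add
        ((tendsto_finsetSum Finset.univ fun i _ => hsqrt (haug i)).const_mul 12)
      simp only [Finset.sum_const_zero, mul_zero, add_zero] at hlim
      have := ENNReal.tendsto_ofReal hlim
      rw [ENNReal.ofReal_zero] at this
      exact tendsto_of_tendsto_of_tendsto_of_le_of_le tendsto_const_nhds this
        (fun n => zero_le) fun n => hmodel.eLpNorm_gpMean_sub_aggMean_le (d n) lead x hM
    -- Both variances tend to 0, so their difference does.
    · have hagg : Tendsto (fun n => (DecGP.aggPrec θ (d n) lead x)⁻¹) atTop (𝓝 0) :=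
        squeeze_zero (fun n => (inv_pos.2 (hmodel.aggPrec_pos (d n) lead x)).le)
          (fun n => (hmodel.agg_bounds (d n) lead x ⟨0, hM⟩).1)
          (by simpa using (haug ⟨0, hM⟩).const_mul 4)
      simpa using hfull.sub hagg
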